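/- For $\alpha>0$ and $x\in\mathbb{R}$ let $E_\alpha(x)=\sum_{n\ge 0}\frac{x^n}{\Gamma(1+n\alpha)}$ be the Mittag-Leffler function. For every $0<\alpha<\beta<1$ there exists $x_{\alpha,\beta}\in(0,1)$ such that the function $$x\mapsto E_\alpha(-x^\alpha)-E_\beta(-x^\beta)$$ is negative for $x\in(0,x_{\alpha,\beta})$ and positive for $x\in(x_{\alpha,\beta},\infty)$. Moreover, $$\left(\frac{1}{\Gamma(1-\beta)\,\Gamma(1+\alpha)}\right)^{\frac{1}{\beta-\alpha}}<x_{\alpha,\beta}<\left(\frac{\Gamma(1+\beta)}{\Gamma(1+\alpha)}\right)^{\frac{1}{\beta-\alpha}}.$$ Consequently, for every $x\ge 1$ the mapping $\alpha\mapsto E_\alpha(-x^\alpha)$ is strictly decreasing on $(0,1)$. -/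

import Mathlib

/-- The classical Mittag-Leffler function `E_α(x) = ∑_{n ≥ 0} x ^ n / Γ(1 + n α)`
of a real variable `x`, with parameter `α > 0`. -/
noncomputable def mittagLeffler (α x : ℝ) : ℝ :=
  ∑' n : ℕ, x ^ n / Real.Gamma (1 + n * α)

/-- The series defining `mittagLeffler α x` converges (absolutely) for every `α > 0` and
every real `x`, so that the sum above is never a default value. -/
theorem mittagLeffler_summable {α : ℝ} (hα : 0 < α) (x : ℝ) :
    Summable fun n : ℕ => x ^ n / Real.Gamma (1 + n * α) := by
  set R : ℝ := max 1 |x| with hR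
  have hR1 : 1 ≤ R := le_max_left _ _
  have hR0 : 0 < R := by linarith
  set S : ℝ := R ^ (1 / α) with hS
  have hS0 : 0 < S := Real.rpow_pos_of_pos hR0 _
  have hS1 : 1 ≤ S := Real.one_le_rpow hR1 (by positivity)
  set q : ℝ := (2 : ℝ) ^ (-α) with hq
  have hq0 : 0 < q := Real.rpow_pos_of_pos (by norm_num) _
  have hq1 : q < 1 := Real.rpow_lt_one_of_one_lt_of_neg (by norm_num) (by linarith)
  have hgeo : Summable fun n : ℕ => (2 * S * Real.exp (2 * S)) * q ^ n :=
    (summable_geometric_of_lt_one hq0.le hq1).mul_left _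
  refine Summable.of_norm_bounded_eventually_nat hgeo ?_
  have hlarge : ∀ᶠ n : ℕ in Filter.atTop, 1 ≤ (n : ℝ) * α :=
    (tendsto_natCast_atTop_atTop.atTop_mul_const hα).eventually_ge_atTop 1
  filter_upwards [hlarge] with n hn
  set k : ℕ := ⌊(n : ℝ) * α⌋₊ with hk
  have hk1 : (k : ℝ) ≤ n * α := Nat.floor_le (by linarith)
  have hk2 : (n : ℝ) * α < k + 1 := Nat.lt_floor_add_one _
  have hkpos : (1 : ℝ) ≤ k := by
    exact_mod_cast (Nat.one_le_floor_iff _).2 hn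
  have hfac : (0 : ℝ) < k.factorial := by exact_mod_cast k.factorial_pos
  have hG : (k.factorial : ℝ) ≤ Real.Gamma (1 + n * α) := by
    rw [← Real.Gamma_nat_eq_factorial]
    exact Real.Gamma_strictMonoOn_Ici.monotoneOn
      (Set.mem_Ici.2 (by linarith)) (Set.mem_Ici.2 (by linarith)) (by linarith)
  have hx : |x| ^ n ≤ S ^ (k + 1) := by
    calc |x| ^ n ≤ R ^ n := pow_le_pow_left₀ (abs_nonneg x) (le_max_right _ _) n
      _ = S ^ ((n : ℝ) * α) := by
        rw [hS, ← Real.rpow_mul hR0.le, ← Real.rpow_natCast]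
        congr 1
        field_simp
      _ ≤ S ^ ((k + 1 : ℕ) : ℝ) :=
        Real.rpow_le_rpow_of_exponent_le hS1 (by push_cast; linarith)
      _ = S ^ (k + 1) := Real.rpow_natCast _ _
  have hexp : (2 * S) ^ k / k.factorial ≤ Real.exp (2 * S) :=
    Real.pow_div_factorial_le_exp _ (by positivity) k
  have h2 : (1 : ℝ) ≤ 2 * q ^ n * 2 ^ k := by
    have e : 2 * q ^ n * 2 ^ k = (2 : ℝ) ^ ((k : ℝ) + 1 - n * α) := by
      rw [hq, ← Real.rpow_natCast, ← Real.rpow_natCast, ← Real.rpow_mul (by norm_num),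
        Real.rpow_sub (by norm_num), Real.rpow_add (by norm_num), Real.rpow_one,
        show -α * (n : ℝ) = -(n * α) by ring, Real.rpow_neg (by norm_num)]
      ring
    rw [e]
    exact Real.one_le_rpow (by norm_num) (by linarith)
  rw [norm_div, norm_pow, Real.norm_eq_abs, Real.norm_of_nonneg (hfac.le.trans hG)]
  calc |x| ^ n / Real.Gamma (1 + n * α) ≤ S ^ (k + 1) / k.factorial :=
        div_le_div₀ (by positivity) hx hfac hG
    _ ≤ S ^ (k + 1) / k.factorial * (2 * q ^ n * 2 ^ k) :=
        le_mul_of_one_le_right (by positivity) h2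
    _ = 2 * S * q ^ n * ((2 * S) ^ k / k.factorial) := by rw [mul_pow]; ring
    _ ≤ 2 * S * q ^ n * Real.exp (2 * S) := mul_le_mul_of_nonneg_left hexp (by positivity)
    _ = 2 * S * Real.exp (2 * S) * q ^ n := by ring

/-! Write F_α(x) = E_α(-x^α). Hankel's formula expresses x^a/Γ(1+a) as a contour integral. Summing
over a = nα is a geometric series, and collapsing the contour gives F_α(x) = ∫ exp(-x e^u) `density
α u` du with an explicit positive even density of mass 1 (`mittagLeffler_eq_integral`).

For α < β the difference of densities has zero integral and is negative exactly on (-u₀, u₀),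
positive outside [-u₀, u₀] (`exists_density_crossing`). Hence f = F_α - F_β changes sign at most
once: f(x) ≥ 0 forces f(y) > 0 for y > x, by comparing exp(-y e^u), a convex function of exp(-x
e^u), with a chord (`mittagLeffler_sub_pos_of_lt`). Evenness of the densities gives f(1) > 0
(`mittagLeffler_sub_pos_one`).

The bounds on the zero come from the monotonicity of F_α and its Volterra equation. They give 1/(1 +
Γ(1-α)x^α) ≤ F_α(x) < 1/(1 + x^α/Γ(1+α)), so f < 0 at the lower endpoint, where the upper bound for
F_α meets the lower bound for F_β. At the upper endpoint the two Volterra kernels have equal mass,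
and comparing them rules out f < 0 on all of (0, x) together with f(x) ≤ 0
(`mittagLeffler_lt_of_forall_lt`). -/

namespace MittagLeffler

open MeasureTheory Set Filter Topology
open scoped Real

/-! ### Contour integrals over the boundary of a half strip -/

/-- The integrand on the two horizontal sides of the strip `|Im w| ≤ π`. -/
noncomputable def jump (f : ℂ → ℂ) (u : ℝ) : ℂ :=
  f (u + π * Complex.I) - f (u - π * Complex.I)

/-- The integral over the segment `Re w = A`, `|Im w| ≤ π`. -/
noncomputable def vertical (A : ℝ) (f : ℂ → ℂ) : ℂ :=
  Complex.I * ∫ θ in (-π)..π, f (A + θ * Complex.I)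

/-- The integral of `f` over the boundary of the half strip `A ≤ Re w`, `|Im w| ≤ π`: the image
of a Hankel contour under the logarithm. -/
noncomputable def hankel (A : ℝ) (f : ℂ → ℂ) : ℂ :=
  vertical A f + ∫ u in Ioi A, jump f u

/-- Cauchy's theorem on the rectangle with real parts between B and A. -/
theorem vertical_sub_vertical {f : ℂ → ℂ} (hf : DifferentiableOn ℂ f {w | |w.im| ≤ π})
    (A B : ℝ) : vertical A f - vertical B f = ∫ u in B..A, jump f u := by
  have hc : ∀ t : ℝ, |t| ≤ π → Continuous fun u : ℝ => f (u + t * Complex.I) := by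
    intro t ht
    refine hf.continuousOn.comp_continuous (by fun_prop) fun u => ?_
    simpa using ht
  have h := Complex.integral_boundary_rect_eq_zero_of_differentiableOn f
    (⟨B, -π⟩ : ℂ) ⟨A, π⟩ (hf.mono ?_)
  · have h1 : ∫ u in B..A, jump f u =
        (∫ u : ℝ in B..A, f (u + π * Complex.I)) - ∫ u : ℝ in B..A, f (u - π * Complex.I) := by
      refine intervalIntegral.integral_sub ((hc π ?_).intervalIntegrable _ _) ?_
      · rw [abs_of_pos Real.pi_pos]
      · have := (hc (-π) (by rw [abs_neg, abs_of_pos Real.pi_pos])).intervalIntegrable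
          (μ := volume) B A
        simpa [← sub_eq_add_neg] using this
    rw [h1, vertical, vertical]
    simp only [smul_eq_mul, Complex.ofReal_neg, neg_mul, ← sub_eq_add_neg] at h
    linear_combination h
  · rintro w ⟨-, hw⟩
    simp only [mem_preimage] at hw
    rw [uIcc_of_le (by linarith [Real.pi_pos])] at hw
    exact abs_le.2 hw

theorem tendsto_vertical_atBot {f : ℂ → ℂ} {b : ℝ → ℝ} (hb : Tendsto b atBot (𝓝 0))
    (h : ∀ᶠ B : ℝ in atBot, ∀ θ : ℝ, |θ| ≤ π → ‖f (B + θ * Complex.I)‖ ≤ b B) :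
    Tendsto (fun B => vertical B f) atBot (𝓝 0) := by
  have hb' : Tendsto (fun B => b B * |π - -π|) atBot (𝓝 0) := by
    simpa using hb.mul_const |π - -π|
  refine squeeze_zero_norm' ?_ hb'
  filter_upwards [h] with B hB
  rw [vertical, norm_mul, Complex.norm_I, one_mul]
  refine intervalIntegral.norm_integral_le_of_norm_le_const fun θ hθ => hB θ ?_
  rw [uIoc_of_le (by linarith [Real.pi_pos])] at hθ
  exact abs_le.2 ⟨hθ.1.le, hθ.2⟩

/-- Pushing the vertical side to -∞ collapses the contour onto the two horizontal lines. -/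
theorem hankel_eq_integral {f : ℂ → ℂ} (hf : DifferentiableOn ℂ f {w | |w.im| ≤ π})
    (hint : Integrable (jump f)) (hlim : Tendsto (fun B => vertical B f) atBot (𝓝 0)) (A : ℝ) :
    hankel A f = ∫ u, jump f u := by
  have h1 : vertical A f = ∫ u in Iic A, jump f u := by
    refine tendsto_nhds_unique ?_
      (intervalIntegral_tendsto_integral_Iic A hint.integrableOn tendsto_id)
    refine ((tendsto_const_nhds (x := vertical A f)).sub hlim).congr' ?_ |>.trans (by simp)
    exact Eventually.of_forall fun B => vertical_sub_vertical hf A B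
  have h2 := setIntegral_union (Iic_disjoint_Ioi (le_refl A)) measurableSet_Ioi
    hint.integrableOn hint.integrableOn
  rw [Iic_union_Ioi, setIntegral_univ] at h2
  rw [hankel, h1, h2]

/-! ### Hankel's formula for the reciprocal Gamma function -/

theorem integrable_exp_neg_mul_exp_add {x p : ℝ} (hx : 0 < x) (hp : 0 < p) :
    Integrable fun u : ℝ => Real.exp (-(x * Real.exp u) + p * u) := by
  have h : IntegrableOn (fun t : ℝ => t ^ (p - 1) * Real.exp (-(x * t))) (Ioi 0) := by
    simpa using integrableOn_rpow_mul_exp_neg_mul_rpow (s := p - 1) (p := 1) (b := x)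
      (by linarith) one_pos hx
  have himg : Real.exp '' univ = Ioi 0 := by rw [image_univ, Real.range_exp]
  rw [← himg, integrableOn_image_iff_integrableOn_abs_deriv_smul MeasurableSet.univ
    (fun u _ => (Real.hasDerivAt_exp u).hasDerivWithinAt) Real.exp_injective.injOn,
    integrableOn_univ] at h
  refine h.congr (Eventually.of_forall fun u => ?_)
  simp only [abs_of_pos (Real.exp_pos u), smul_eq_mul]
  rw [← Real.exp_mul, ← Real.exp_add, ← Real.exp_add]
  ring_nf

/-- Euler's Gamma integral after the substitution t = exp u. -/
theorem integral_exp_neg_mul_exp_add {x p : ℝ} (hx : 0 < x) (hp : 0 < p) :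
    ∫ u : ℝ, Real.exp (-(x * Real.exp u) + p * u) = x ^ (-p) * Real.Gamma p := by
  have h := Real.integral_rpow_mul_exp_neg_mul_Ioi hp hx
  have himg : Real.exp '' univ = Ioi 0 := by rw [image_univ, Real.range_exp]
  rw [← himg, integral_image_eq_integral_abs_deriv_smul MeasurableSet.univ
    (fun u _ => (Real.hasDerivAt_exp u).hasDerivWithinAt) Real.exp_injective.injOn,
    setIntegral_univ] at h
  rw [Real.rpow_neg hx.le, ← Real.inv_rpow hx.le, ← one_div, ← h]
  refine integral_congr_ae (Eventually.of_forall fun u => ?_)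
  simp only [abs_of_pos (Real.exp_pos u), smul_eq_mul]
  rw [← Real.exp_mul, ← Real.exp_add, ← Real.exp_add]
  ring_nf

/-- The integrand of Hankel's integral for `x ^ a / Γ(1 + a)`, in logarithmic coordinates. -/
noncomputable def hankelKernel (x a : ℝ) (w : ℂ) : ℂ :=
  Complex.exp (x * Complex.exp w - a * w)

theorem differentiable_hankelKernel (x a : ℝ) : Differentiable ℂ (hankelKernel x a) := by
  unfold hankelKernel; fun_prop

theorem jump_hankelKernel (x a u : ℝ) :
    jump (hankelKernel x a) u =
      (-2 * Complex.I * Real.sin (π * a)) * (Real.exp (-(x * Real.exp u) - a * u) : ℝ) := by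
  have e1 : Complex.exp (u + π * Complex.I) = -Complex.exp u := by
    rw [Complex.exp_add, Complex.exp_pi_mul_I]; ring
  have e2 : Complex.exp (u - π * Complex.I) = -Complex.exp u := by
    rw [Complex.exp_sub, Complex.exp_pi_mul_I]; ring
  have e3 : (x * -Complex.exp u - a * (u + π * Complex.I) : ℂ) =
      (-(x * Complex.exp u) - a * u) + (-(π * a : ℂ)) * Complex.I := by ring
  have e4 : (x * -Complex.exp u - a * (u - π * Complex.I) : ℂ) =
      (-(x * Complex.exp u) - a * u) + ((π * a : ℂ)) * Complex.I := by ring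
  rw [jump, hankelKernel, hankelKernel, e1, e2, e3, e4, Complex.exp_add, Complex.exp_add,
    Complex.exp_mul_I, Complex.exp_mul_I, Complex.cos_neg, Complex.sin_neg]
  push_cast
  ring

theorem norm_hankelKernel (x a A θ : ℝ) :
    ‖hankelKernel x a (A + θ * Complex.I)‖ =
      Real.exp (x * (Real.exp A * Real.cos θ) - a * A) := by
  rw [hankelKernel, Complex.norm_exp]
  congr 1
  simp [Complex.exp_re]

theorem integrable_jump_hankelKernel {x a : ℝ} (hx : 0 < x) (ha : a < 0) :
    Integrable (jump (hankelKernel x a)) := by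
  have h := (integrable_exp_neg_mul_exp_add hx (neg_pos.2 ha)).ofReal (𝕜 := ℂ)
  refine (h.const_mul (-2 * Complex.I * Real.sin (π * a))).congr
    (Eventually.of_forall fun u => ?_)
  simp only [jump_hankelKernel, neg_mul, sub_eq_add_neg]
  norm_cast

theorem integrableOn_exp_neg_mul_exp_sub {x : ℝ} (hx : 0 < x) (a A : ℝ) :
    IntegrableOn (fun u : ℝ => Real.exp (-(x * Real.exp u) - a * u)) (Ioi A) := by
  have h := ((integrable_exp_neg_mul_exp_add hx (p := |a| + 1) (by positivity)).const_mul
    (Real.exp (-(a + |a| + 1) * A))).integrableOn (s := Ioi A)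
  refine h.mono' (by fun_prop) ?_
  filter_upwards [ae_restrict_mem measurableSet_Ioi] with u hu
  rw [Real.norm_of_nonneg (Real.exp_pos _).le, ← Real.exp_add]
  have : 0 ≤ (a + |a| + 1) * (u - A) :=
    mul_nonneg (by linarith [neg_abs_le a]) (by linarith [mem_Ioi.1 hu])
  exact Real.exp_le_exp.2 (by nlinarith)

theorem integrableOn_jump_hankelKernel {x : ℝ} (hx : 0 < x) (a A : ℝ) :
    IntegrableOn (jump (hankelKernel x a)) (Ioi A) := by
  have h := (integrableOn_exp_neg_mul_exp_sub hx a A).ofReal (𝕜 := ℂ)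
  refine (h.const_mul (-2 * Complex.I * Real.sin (π * a))).congr
    (Eventually.of_forall fun u => ?_)
  simp only [jump_hankelKernel]
  norm_cast

/-- For a < 0 the vertical side vanishes at -∞, leaving an Euler integral Γ(-a); the reflection
formula absorbs the factor sin(πa) from the jump. -/
theorem hankel_hankelKernel_of_neg {x a : ℝ} (hx : 0 < x) (ha1 : -1 < a) (ha : a < 0) (A : ℝ) :
    hankel A (hankelKernel x a) =
      2 * π * Complex.I * ((x ^ a / Real.Gamma (1 + a) : ℝ) : ℂ) := by
  rw [hankel_eq_integral (differentiable_hankelKernel x a).differentiableOn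
    (integrable_jump_hankelKernel hx ha)]
  · simp_rw [jump_hankelKernel]
    rw [integral_const_mul, integral_complex_ofReal]
    have h := integral_exp_neg_mul_exp_add hx (neg_pos.2 ha)
    simp only [neg_mul, ← sub_eq_add_neg, neg_neg] at h
    rw [h]
    have hG : Real.Gamma (-a) * Real.Gamma (1 + a) = π / Real.sin (π * -a) := by
      rw [← Real.Gamma_mul_Gamma_one_sub]; ring_nf
    have hs : Real.sin (π * -a) ≠ 0 := by
      refine (Real.sin_pos_of_pos_of_lt_pi ?_ ?_).ne'
      · exact mul_pos Real.pi_pos (by linarith)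
      · nlinarith [Real.pi_pos]
    have hG1 : Real.Gamma (1 + a) ≠ 0 := (Real.Gamma_pos_of_pos (by linarith)).ne'
    have key : -Real.sin (π * a) * (x ^ a * Real.Gamma (-a)) =
        π * (x ^ a / Real.Gamma (1 + a)) := by
      rw [show π * -a = -(π * a) by ring, Real.sin_neg] at hG hs
      rw [eq_div_iff hs] at hG
      rw [← mul_div_assoc, eq_div_iff hG1]
      linear_combination x ^ a * hG
    have key' := congrArg (fun r : ℝ => (r : ℂ)) key
    simp only [Complex.ofReal_mul, Complex.ofReal_neg] at key' ⊢
    linear_combination 2 * Complex.I * key'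
  · refine tendsto_vertical_atBot (b := fun B => Real.exp (x * 1 - a * B)) ?_ ?_
    · refine Real.tendsto_exp_atBot.comp ?_
      refine tendsto_atBot_add_const_left _ (x * 1) ?_ |>.congr fun B => (sub_eq_add_neg _ _).symm
      have := tendsto_id.const_mul_atBot (neg_pos.2 ha)
      simpa using this
    · filter_upwards [eventually_le_atBot 0] with B hB θ _
      rw [norm_hankelKernel]
      refine Real.exp_le_exp.2 (sub_le_sub_right (mul_le_mul_of_nonneg_left ?_ hx.le) _)
      have h1 : Real.exp B ≤ 1 := Real.exp_le_one_iff.2 hB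
      nlinarith [Real.cos_le_one θ, Real.exp_pos B]

/-- For a = 0 the kernel is 2πi-periodic, so its jump is zero, but it tends to 1 at -∞. Subtracting
1 restores decay, and the constant contributes 2πi. -/
theorem hankel_hankelKernel_zero {x : ℝ} (hx : 0 < x) (A : ℝ) :
    hankel A (hankelKernel x 0) = 2 * π * Complex.I := by
  have hj : jump (fun w => hankelKernel x 0 w - 1) = 0 := by
    ext u
    have := jump_hankelKernel x 0 u
    simp only [jump, mul_zero, Real.sin_zero, Complex.ofReal_zero, zero_mul] at this
    simp only [jump, Pi.zero_apply]
    linear_combination this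
  have h := hankel_eq_integral (f := fun w => hankelKernel x 0 w - 1)
    ((differentiable_hankelKernel x 0).sub_const 1).differentiableOn
    (by rw [hj]; exact integrable_zero _ _ _) ?_ A
  · have hj' : jump (hankelKernel x 0) = 0 := by
      ext u; rw [jump_hankelKernel]; simp
    have hc : Continuous fun θ : ℝ => hankelKernel x 0 (A + θ * Complex.I) :=
      (differentiable_hankelKernel x 0).continuous.comp (by fun_prop)
    simp only [hankel, hj, hj', vertical, Pi.zero_apply, integral_zero, add_zero] at h ⊢
    rw [intervalIntegral.integral_sub (hc.intervalIntegrable _ _) (by simp)] at h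
    simp only [intervalIntegral.integral_const, sub_neg_eq_add, Complex.real_smul] at h
    push_cast at h
    linear_combination h
  · refine tendsto_vertical_atBot (b := fun B => 2 * (x * Real.exp B)) ?_ ?_
    · simpa using (Real.tendsto_exp_atBot.const_mul x).const_mul 2
    · have h1 : ∀ᶠ B in atBot, x * Real.exp B ≤ 1 := by
        have := Real.tendsto_exp_atBot.const_mul x
        rw [mul_zero] at this
        exact this.eventually_le_const one_pos
      filter_upwards [h1] with B hB θ _
      have hn : ‖(x * Complex.exp (B + θ * Complex.I) : ℂ)‖ = x * Real.exp B := by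
        rw [norm_mul, Complex.norm_exp]
        simp [abs_of_pos hx]
      have := Complex.norm_exp_sub_one_le (x := x * Complex.exp (B + θ * Complex.I))
        (by rw [hn]; exact hB)
      rw [hn] at this
      simpa [hankelKernel] using this

theorem hasDerivAt_hankelKernel (x a : ℝ) (w : ℂ) :
    HasDerivAt (hankelKernel x a) (x * hankelKernel x (a - 1) w - a * hankelKernel x a w) w := by
  have h := ((((Complex.hasDerivAt_exp w).const_mul (x : ℂ)).sub
    ((hasDerivAt_id w).const_mul (a : ℂ))).cexp)
  refine h.congr_deriv ?_
  have : hankelKernel x (a - 1) w = hankelKernel x a w * Complex.exp w := by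
    rw [hankelKernel, hankelKernel, ← Complex.exp_add]; push_cast; ring_nf
  rw [this]
  simp only [hankelKernel, id, Pi.sub_apply]
  ring

theorem tendsto_jump_hankelKernel {x : ℝ} (hx : 0 < x) (a : ℝ) :
    Tendsto (jump (hankelKernel x a)) atTop (𝓝 0) := by
  have h : Tendsto (fun u : ℝ => Real.exp (-(x * Real.exp u) - a * u)) atTop (𝓝 0) := by
    have h0 : Tendsto (fun t : ℝ => t ^ (-a) * Real.exp (-x * t)) atTop (𝓝 0) :=
      tendsto_rpow_mul_exp_neg_mul_atTop_nhds_zero _ _ hx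
    refine (h0.comp Real.tendsto_exp_atTop).congr fun u => ?_
    simp only [Function.comp]
    rw [← Real.exp_mul, ← Real.exp_add]
    ring_nf
  have h2 := (Complex.continuous_ofReal.tendsto 0).comp h
  have h3 := h2.const_mul (-2 * Complex.I * Real.sin (π * a))
  simp only [Complex.ofReal_zero, mul_zero] at h3
  exact h3.congr fun u => (jump_hankelKernel x a u).symm

/-- The derivative of the kernel integrates to zero over the contour: the corner terms at A cancel
and the ends at +∞ vanish. This is the functional equation of 1/Γ. -/
theorem hankel_hankelKernel_sub_one {x : ℝ} (hx : 0 < x) (a A : ℝ) :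
    x * hankel A (hankelKernel x (a - 1)) = a * hankel A (hankelKernel x a) := by
  have hcont : ∀ c : ℝ, Continuous (hankelKernel x c) :=
    fun c => (differentiable_hankelKernel x c).continuous
  have hv : x * vertical A (hankelKernel x (a - 1)) - a * vertical A (hankelKernel x a) =
      jump (hankelKernel x a) A := by
    have hd : ∀ θ : ℝ, HasDerivAt (fun θ : ℝ => hankelKernel x a (A + θ * Complex.I))
        ((x * hankelKernel x (a - 1) (A + θ * Complex.I) -
          a * hankelKernel x a (A + θ * Complex.I)) * Complex.I) θ := by
      intro θ
      have hl : HasDerivAt (fun θ : ℂ => (A + θ * Complex.I : ℂ)) Complex.I θ := by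
        simpa using ((hasDerivAt_id (θ : ℂ)).mul_const Complex.I).const_add (A : ℂ)
      exact ((hasDerivAt_hankelKernel x a _).comp (θ : ℂ) hl).comp_ofReal
    have hF := intervalIntegral.integral_eq_sub_of_hasDerivAt (a := -π) (b := π)
      (fun θ _ => hd θ) (Continuous.intervalIntegrable (by fun_prop) _ _)
    have hc : ∀ c : ℝ, IntervalIntegrable
        (fun θ : ℝ => hankelKernel x c (A + θ * Complex.I)) volume (-π) π :=
      fun c => Continuous.intervalIntegrable (by fun_prop) _ _
    rw [intervalIntegral.integral_mul_const, intervalIntegral.integral_sub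
      ((hc _).const_mul _) ((hc _).const_mul _), intervalIntegral.integral_const_mul,
      intervalIntegral.integral_const_mul] at hF
    simp only [vertical, jump]
    push_cast at hF
    rw [sub_eq_add_neg (A : ℂ), ← neg_mul]
    linear_combination hF
  have hr : x * (∫ u in Ioi A, jump (hankelKernel x (a - 1)) u) -
      a * (∫ u in Ioi A, jump (hankelKernel x a) u) = -jump (hankelKernel x a) A := by
    have hd : ∀ u : ℝ, HasDerivAt (jump (hankelKernel x a))
        (x * jump (hankelKernel x (a - 1)) u - a * jump (hankelKernel x a) u) u := by
      intro u
      have hl : ∀ c : ℂ, HasDerivAt (fun u : ℝ => hankelKernel x a (u + c))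
          (x * hankelKernel x (a - 1) (u + c) - a * hankelKernel x a (u + c)) u := by
        intro c
        have := (hasDerivAt_hankelKernel x a (u + c)).comp (u : ℂ)
          ((hasDerivAt_id (u : ℂ)).add_const c)
        rw [mul_one] at this
        exact this.comp_ofReal
      have h := (hl (π * Complex.I)).sub (hl (-(π * Complex.I)))
      simp only [← sub_eq_add_neg] at h
      refine h.congr_deriv ?_
      simp only [jump]
      ring
    have hF := integral_Ioi_of_hasDerivAt_of_tendsto' (a := A) (fun u _ => hd u)
      (((integrableOn_jump_hankelKernel hx _ A).const_mul _).sub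
        ((integrableOn_jump_hankelKernel hx _ A).const_mul _)) (tendsto_jump_hankelKernel hx a)
    rw [integral_sub ((integrableOn_jump_hankelKernel hx _ A).const_mul _)
      ((integrableOn_jump_hankelKernel hx _ A).const_mul _), integral_const_mul,
      integral_const_mul, zero_sub] at hF
    exact hF
  rw [hankel, hankel]
  linear_combination hv + hr

/-- **Hankel's formula** for the reciprocal Gamma function. -/
theorem hankel_hankelKernel {x a : ℝ} (hx : 0 < x) (ha : -1 < a) (A : ℝ) :
    hankel A (hankelKernel x a) =
      2 * π * Complex.I * ((x ^ a / Real.Gamma (1 + a) : ℝ) : ℂ) := by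
  -- The functional equation lowers a by 1 until it reaches (-1, 0].
  obtain ⟨n, hn⟩ := exists_nat_ge a
  induction n generalizing a with
  | zero =>
    rcases eq_or_lt_of_le hn with h0 | h0
    · simp only [CharP.cast_eq_zero] at h0
      subst h0
      rw [hankel_hankelKernel_zero hx]; simp
    · exact hankel_hankelKernel_of_neg hx ha (by simpa using h0) A
  | succ n ih =>
    rcases le_or_gt a 0 with h0 | h0
    · rcases eq_or_lt_of_le h0 with h0 | h0
      · subst h0
        rw [hankel_hankelKernel_zero hx]; simp
      · exact hankel_hankelKernel_of_neg hx ha h0 A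
    · have h1 := ih (a := a - 1) (by linarith) (by push_cast at hn; linarith)
      have h2 := hankel_hankelKernel_sub_one hx a A
      rw [h1] at h2
      have h3 : x * (x ^ (a - 1) / Real.Gamma (1 + (a - 1))) =
          a * (x ^ a / Real.Gamma (1 + a)) := by
        have : Real.Gamma a ≠ 0 := (Real.Gamma_pos_of_pos h0).ne'
        rw [Real.rpow_sub_one hx.ne', add_comm 1 a, Real.Gamma_add_one h0.ne',
          add_sub_cancel]
        field_simp
      have h4 := congrArg (fun r : ℝ => (r : ℂ)) h3
      simp only [Complex.ofReal_mul] at h4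
      have h5 : (a : ℂ) ≠ 0 := by exact_mod_cast h0.ne'
      refine mul_left_cancel₀ h5 ?_
      linear_combination -h2 + 2 * π * Complex.I * h4

/-! ### The density: positivity, symmetry, integrability -/

/-- The density, in logarithmic coordinates, of the measure whose Laplace transform is
`x ↦ E_α(-x ^ α)`. -/
noncomputable def density (α u : ℝ) : ℝ :=
  Real.sin (π * α) / (π * (Real.exp (α * u) + Real.exp (-(α * u)) + 2 * Real.cos (π * α)))

theorem sin_pi_mul_pos {α : ℝ} (h0 : 0 < α) (h1 : α < 1) : 0 < Real.sin (π * α) :=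
  Real.sin_pos_of_pos_of_lt_pi (by positivity) (by nlinarith [Real.pi_pos])

theorem neg_one_lt_cos_pi_mul {α : ℝ} (h0 : 0 < α) (h1 : α < 1) : -1 < Real.cos (π * α) := by
  rw [← Real.cos_pi]
  exact Real.cos_lt_cos_of_nonneg_of_le_pi (by positivity) le_rfl (by nlinarith [Real.pi_pos])

theorem two_le_exp_add_exp_neg (t : ℝ) : 2 ≤ Real.exp t + Real.exp (-t) := by
  have h := Real.exp_pos t
  have : Real.exp t * Real.exp (-t) = 1 := by rw [← Real.exp_add]; simp
  nlinarith [sq_nonneg (Real.exp t - Real.exp (-t)), Real.exp_pos (-t)]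

theorem density_denom_pos {α : ℝ} (h0 : 0 < α) (h1 : α < 1) (u : ℝ) :
    0 < Real.exp (α * u) + Real.exp (-(α * u)) + 2 * Real.cos (π * α) := by
  linarith [neg_one_lt_cos_pi_mul h0 h1, two_le_exp_add_exp_neg (α * u)]

theorem density_pos {α : ℝ} (h0 : 0 < α) (h1 : α < 1) (u : ℝ) : 0 < density α u :=
  div_pos (sin_pi_mul_pos h0 h1) (mul_pos Real.pi_pos (density_denom_pos h0 h1 u))

theorem density_neg (α u : ℝ) : density α (-u) = density α u := by
  simp only [density, mul_neg, neg_neg]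
  rw [add_comm (Real.exp (-(α * u)))]

theorem continuous_density {α : ℝ} (h0 : 0 < α) (h1 : α < 1) : Continuous (density α) := by
  unfold density
  exact Continuous.div (by fun_prop) (by fun_prop)
    fun u => (mul_pos Real.pi_pos (density_denom_pos h0 h1 u)).ne'

theorem integrable_exp_neg_mul_abs {α : ℝ} (h0 : 0 < α) :
    Integrable fun u : ℝ => Real.exp (-α * |u|) := by
  have h : IntegrableOn (fun u : ℝ => Real.exp (-α * |u|)) (Ioi 0) :=
    (exp_neg_integrableOn_Ioi 0 h0).congr_fun
      (fun u hu => by simp only [abs_of_pos (mem_Ioi.1 hu)]) measurableSet_Ioi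
  have h' : IntegrableOn (fun u : ℝ => Real.exp (-α * |u|)) (Iic 0) := by
    have : IntegrableOn (fun u : ℝ => Real.exp (-α * |u|)) (Ici (-0)) := by
      rw [neg_zero]; rwa [integrableOn_Ici_iff_integrableOn_Ioi]
    simpa using this.comp_neg_Iic
  rw [← integrableOn_univ, ← Iic_union_Ioi (a := (0 : ℝ))]
  exact h'.union h

theorem integrable_density {α : ℝ} (h0 : 0 < α) (h1 : α < 1) : Integrable (density α) := by
  -- With this δ, X + 2 cos(πα) ≥ δX for every X ≥ 2, so the denominator dominates exp(α|u|).
  set δ := (1 + Real.cos (π * α)) / 2 with hδ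
  have hc := neg_one_lt_cos_pi_mul h0 h1
  have hc1 := Real.cos_le_one (π * α)
  have hδ0 : 0 < δ := by rw [hδ]; linarith
  refine ((integrable_exp_neg_mul_abs h0).const_mul (Real.sin (π * α) / (π * δ))).mono'
    (continuous_density h0 h1).aestronglyMeasurable (Eventually.of_forall fun u => ?_)
  rw [Real.norm_of_nonneg (density_pos h0 h1 u).le, density]
  have hX := two_le_exp_add_exp_neg (α * u)
  have hE : Real.exp (α * |u|) ≤ Real.exp (α * u) + Real.exp (-(α * u)) := by
    rcases abs_cases u with ⟨h, _⟩ | ⟨h, _⟩ <;> rw [h]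
    · linarith [Real.exp_pos (-(α * u))]
    · rw [mul_neg]; linarith [Real.exp_pos (α * u)]
  have hD : δ * Real.exp (α * |u|) ≤
      Real.exp (α * u) + Real.exp (-(α * u)) + 2 * Real.cos (π * α) := by
    have : δ * Real.exp (α * |u|) ≤ δ * (Real.exp (α * u) + Real.exp (-(α * u))) :=
      mul_le_mul_of_nonneg_left hE hδ0.le
    have h2 : 0 ≤ (1 - δ) * (Real.exp (α * u) + Real.exp (-(α * u)) - 2) :=
      mul_nonneg (by rw [hδ]; linarith) (by linarith)
    rw [hδ] at *
    nlinarith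
  calc _ ≤ Real.sin (π * α) / (π * (δ * Real.exp (α * |u|))) :=
        div_le_div_of_nonneg_left (sin_pi_mul_pos h0 h1).le (by positivity)
          (mul_le_mul_of_nonneg_left hD Real.pi_pos.le)
    _ = _ := by
      rw [neg_mul, Real.exp_neg]
      field_simp

/-- A zero would need α Im w to be an odd multiple of π, which α < 1 excludes in the strip. -/
theorem one_add_cexp_ne_zero {α : ℝ} (h0 : 0 < α) (h1 : α < 1) {w : ℂ} (hw : |w.im| ≤ π) :
    1 + Complex.exp (-α * w) ≠ 0 := by
  intro h
  have him := congrArg Complex.im h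
  have hre := congrArg Complex.re h
  simp only [Complex.add_im, Complex.one_im, Complex.exp_im, Complex.add_re, Complex.one_re,
    Complex.exp_re, Complex.mul_re, Complex.mul_im, Complex.neg_re, Complex.neg_im,
    Complex.ofReal_re, Complex.ofReal_im, Complex.zero_re, Complex.zero_im, neg_zero, zero_mul,
    sub_zero, add_zero, zero_add, mul_eq_zero, (Real.exp_pos _).ne', false_or] at him hre
  have hlt : |α * w.im| < π := by
    rw [abs_mul, abs_of_pos h0]
    nlinarith [Real.pi_pos, abs_nonneg w.im]
  have := (Real.sin_eq_zero_iff_of_lt_of_lt (x := -α * w.im) (by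
    linarith [le_abs_self (α * w.im)]) (by linarith [neg_abs_le (α * w.im)])).1 him
  rw [this, Real.cos_zero] at hre
  linarith [Real.exp_pos (-α * w.re)]

/-! ### The summed kernel and the Laplace representation -/

/-- The alternating sum of the kernels `hankelKernel x (n * α)`. -/
noncomputable def sumKernel (x α : ℝ) (w : ℂ) : ℂ :=
  Complex.exp (x * Complex.exp w) / (1 + Complex.exp (-α * w))

theorem differentiableOn_sumKernel (x : ℝ) {α : ℝ} (h0 : 0 < α) (h1 : α < 1) :
    DifferentiableOn ℂ (sumKernel x α) {w | |w.im| ≤ π} := by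
  unfold sumKernel
  exact DifferentiableOn.div (by fun_prop) (by fun_prop) fun w hw => one_add_cexp_ne_zero h0 h1 hw

/-- On the two sides the denominators are the conjugates 1 + r e^{∓iπα} with r = e^{-αu}; the
difference of their reciprocals is 2i sin(πα)/(r⁻¹ + r + 2 cos(πα)). -/
theorem jump_sumKernel (x : ℝ) {α : ℝ} (h0 : 0 < α) (h1 : α < 1) (u : ℝ) :
    jump (sumKernel x α) u =
      2 * π * Complex.I * ((Real.exp (-(x * Real.exp u)) * density α u : ℝ) : ℂ) := by
  have e1 : Complex.exp (u + π * Complex.I) = -Complex.exp u := by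
    rw [Complex.exp_add, Complex.exp_pi_mul_I]; ring
  have e2 : Complex.exp (u - π * Complex.I) = -Complex.exp u := by
    rw [Complex.exp_sub, Complex.exp_pi_mul_I]; ring
  have e3 : Complex.exp (-α * (u + π * Complex.I)) = Complex.exp (-(α * u)) *
      (Complex.cos (π * α) - Complex.sin (π * α) * Complex.I) := by
    rw [show -α * (u + π * Complex.I) = -(α * u : ℂ) + (-(π * α : ℂ)) * Complex.I by ring,
      Complex.exp_add, Complex.exp_mul_I, Complex.cos_neg, Complex.sin_neg]
    ring
  have e4 : Complex.exp (-α * (u - π * Complex.I)) = Complex.exp (-(α * u)) *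
      (Complex.cos (π * α) + Complex.sin (π * α) * Complex.I) := by
    rw [show -α * (u - π * Complex.I) = -(α * u : ℂ) + ((π * α : ℂ)) * Complex.I by ring,
      Complex.exp_add, Complex.exp_mul_I]
  have n1 := one_add_cexp_ne_zero h0 h1 (w := u + π * Complex.I)
    (by simp [abs_of_pos Real.pi_pos])
  have n2 := one_add_cexp_ne_zero h0 h1 (w := u - π * Complex.I)
    (by simp [abs_of_pos Real.pi_pos])
  have n3 : (Complex.exp (α * u) + Complex.exp (-(α * u)) + 2 * Complex.cos (π * α)) ≠ 0 := by
    exact_mod_cast (density_denom_pos h0 h1 u).ne'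
  have n4 : (π : ℂ) ≠ 0 := by exact_mod_cast Real.pi_ne_zero
  rw [jump, sumKernel, sumKernel, e1, e2, density]
  push_cast
  rw [e3] at n1 ⊢
  rw [e4] at n2 ⊢
  have hcs := Complex.sin_sq_add_cos_sq (π * α)
  have hr : Complex.exp (α * u) * Complex.exp (-(α * u)) = 1 := by
    rw [← Complex.exp_add]; simp
  rw [mul_neg]
  -- What remains is a polynomial identity modulo Rr = 1, I² = -1 and s² + c² = 1.
  generalize Complex.exp (-(x * Complex.exp u)) = E
  generalize Complex.exp (-(α * u)) = r at *
  generalize Complex.exp (α * u) = R at *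
  generalize Complex.cos (π * α) = c at *
  generalize Complex.sin (π * α) = s at *
  have hI := Complex.I_sq
  rw [div_sub_div _ _ n1 n2, ← mul_div_assoc, ← mul_div_assoc,
    div_eq_div_iff (mul_ne_zero n1 n2) (mul_ne_zero n4 n3)]
  linear_combination (2 * E * Complex.I * s * π) * hr +
    (2 * E * Complex.I * s * π * r ^ 2 * s ^ 2) * hI - (2 * E * Complex.I * s * π * r ^ 2) * hcs

theorem hankelKernel_natCast_mul (x α : ℝ) (n : ℕ) (w : ℂ) :
    hankelKernel x (n * α) w = Complex.exp (x * Complex.exp w) * Complex.exp (-α * w) ^ n := by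
  rw [hankelKernel, ← Complex.exp_nat_mul, ← Complex.exp_add]
  push_cast
  ring_nf

theorem hasSum_hankelKernel (x : ℝ) {α : ℝ} (h0 : 0 < α) {w : ℂ} (hw : 0 < w.re) :
    HasSum (fun n : ℕ => (-1 : ℂ) ^ n * hankelKernel x (n * α) w) (sumKernel x α w) := by
  have hn : ‖-Complex.exp (-α * w)‖ < 1 := by
    rw [norm_neg, Complex.norm_exp, Real.exp_lt_one_iff]
    simp only [Complex.mul_re, Complex.neg_re, Complex.neg_im, Complex.ofReal_re,
      Complex.ofReal_im]
    nlinarith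
  have h := (hasSum_geometric_of_norm_lt_one hn).mul_left (Complex.exp (x * Complex.exp w))
  rw [sub_neg_eq_add, ← div_eq_mul_inv] at h
  refine h.congr_fun fun n => ?_
  rw [hankelKernel_natCast_mul, neg_pow]
  ring

/-- The kernels are in geometric progression with ratio of norm exp(-αA) < 1 on this side; this is
why A must be positive when summing. -/
theorem hasSum_vertical_hankelKernel {x α : ℝ} (hx : 0 < x) (h0 : 0 < α) {A : ℝ} (hA : 0 < A) :
    HasSum (fun n : ℕ => (-1 : ℂ) ^ n * vertical A (hankelKernel x (n * α)))
      (vertical A (sumKernel x α)) := by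
  have hq : Real.exp (-α * A) < 1 := Real.exp_lt_one_iff.2 (by nlinarith)
  have h := intervalIntegral.hasSum_integral_of_dominated_convergence
    (a := -π) (b := π) (μ := volume)
    (F := fun (n : ℕ) (θ : ℝ) => (-1 : ℂ) ^ n * hankelKernel x (n * α) (A + θ * Complex.I))
    (f := fun θ : ℝ => sumKernel x α (A + θ * Complex.I))
    (fun n _ => Real.exp (x * Real.exp A) * Real.exp (-α * A) ^ n) ?_ ?_ ?_ ?_ ?_
  · simp only [intervalIntegral.integral_const_mul] at h
    refine (h.mul_left Complex.I).congr_fun fun n => ?_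
    simp only [vertical]
    ring
  · intro n
    exact (((differentiable_hankelKernel x (n * α)).continuous.comp
      (by fun_prop : Continuous fun θ : ℝ => (A + θ * Complex.I : ℂ))).const_mul
        _).aestronglyMeasurable
  · refine fun n => Eventually.of_forall fun θ _ => ?_
    rw [norm_mul, norm_pow, norm_neg, norm_one, one_pow, one_mul, norm_hankelKernel,
      ← Real.exp_nat_mul, ← Real.exp_add]
    refine Real.exp_le_exp.2 ?_
    have : x * (Real.exp A * Real.cos θ) ≤ x * (Real.exp A * 1) := by
      gcongr; exact Real.cos_le_one θ
    linarith
  · refine Eventually.of_forall fun θ _ => ?_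
    exact (summable_geometric_of_lt_one (Real.exp_pos _).le hq).mul_left _
  · simp
  · refine Eventually.of_forall fun θ _ => hasSum_hankelKernel x h0 ?_
    simpa using hA

theorem hasSum_integral_jump_hankelKernel {x α : ℝ} (hx : 0 < x) (h0 : 0 < α) {A : ℝ}
    (hA : 0 < A) :
    HasSum (fun n : ℕ => (-1 : ℂ) ^ n * ∫ u in Ioi A, jump (hankelKernel x (n * α)) u)
      (∫ u in Ioi A, jump (sumKernel x α) u) := by
  have hq : Real.exp (-α * A) < 1 := Real.exp_lt_one_iff.2 (by nlinarith)
  have hs := summable_geometric_of_lt_one (Real.exp_pos _).le hq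
  have hi : IntegrableOn (fun u : ℝ => 2 * Real.exp (-(x * Real.exp u))) (Ioi A) := by
    have := (integrableOn_exp_neg_mul_exp_sub hx 0 A).const_mul 2
    simp only [zero_mul, sub_zero] at this
    exact this
  have h := hasSum_integral_of_dominated_convergence (μ := volume.restrict (Ioi A))
    (F := fun (n : ℕ) (u : ℝ) => (-1 : ℂ) ^ n * jump (hankelKernel x (n * α)) u)
    (f := jump (sumKernel x α))
    (fun n u => 2 * Real.exp (-(x * Real.exp u)) * Real.exp (-α * A) ^ n) ?_ ?_ ?_ ?_ ?_
  · simpa only [integral_const_mul] using h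
  · exact fun n => ((integrableOn_jump_hankelKernel hx _ A).const_mul _).aestronglyMeasurable
  · intro n
    filter_upwards [ae_restrict_mem measurableSet_Ioi] with u hu
    rw [norm_mul, norm_pow, norm_neg, norm_one, one_pow, one_mul, jump_hankelKernel, norm_mul,
      norm_mul, norm_mul, norm_neg, Complex.norm_I, Complex.norm_real, Complex.norm_real,
      Real.norm_of_nonneg (Real.exp_pos _).le, ← Real.exp_nat_mul, sub_eq_add_neg, Real.exp_add]
    have h1 : ‖Real.sin (π * (n * α))‖ ≤ 1 := Real.abs_sin_le_one _
    have h2 : Real.exp (-(n * α * u)) ≤ Real.exp (n * (-α * A)) := by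
      refine Real.exp_le_exp.2 ?_
      have : 0 ≤ (n : ℝ) * α * (u - A) := by
        have := sub_nonneg.2 (mem_Ioi.1 hu).le
        positivity
      linarith
    rw [Complex.norm_ofNat, mul_one, mul_assoc 2 (Real.exp _)]
    refine mul_le_mul (by linarith) ?_ (by positivity) (by norm_num)
    gcongr
  · exact Eventually.of_forall fun u => hs.mul_left _
  · simp_rw [tsum_mul_left]
    exact hi.mul_const _
  · filter_upwards [ae_restrict_mem measurableSet_Ioi] with u hu
    have hu0 : 0 < u := hA.trans (mem_Ioi.1 hu)
    have := (hasSum_hankelKernel x h0 (w := u + π * Complex.I) (by simpa using hu0)).sub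
      (hasSum_hankelKernel x h0 (w := u - π * Complex.I) (by simpa using hu0))
    refine this.congr_fun fun n => ?_
    simp only [jump]
    ring

theorem hasSum_hankel_hankelKernel {x α : ℝ} (hx : 0 < x) (h0 : 0 < α) {A : ℝ} (hA : 0 < A) :
    HasSum (fun n : ℕ => (-1 : ℂ) ^ n * hankel A (hankelKernel x (n * α)))
      (hankel A (sumKernel x α)) := by
  simp only [hankel, mul_add]
  exact (hasSum_vertical_hankelKernel hx h0 hA).add (hasSum_integral_jump_hankelKernel hx h0 hA)

theorem hankel_sumKernel {x α : ℝ} (hx : 0 < x) (h0 : 0 < α) {A : ℝ} (hA : 0 < A) :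
    hankel A (sumKernel x α) =
      2 * π * Complex.I * ((mittagLeffler α (-(x ^ α)) : ℝ) : ℂ) := by
  refine (hasSum_hankel_hankelKernel hx h0 hA).unique ?_
  have h := Complex.hasSum_ofReal.2 (mittagLeffler_summable h0 (-(x ^ α))).hasSum
  refine (h.mul_left (2 * π * Complex.I)).congr_fun fun n => ?_
  rw [hankel_hankelKernel hx (by linarith [show (0:ℝ) ≤ n * α by positivity]) A, neg_pow (x ^ α),
    ← Real.rpow_natCast (x ^ α) n, ← Real.rpow_mul hx.le, mul_comm α]
  push_cast
  ring

theorem integrable_exp_neg_mul_exp_mul_density {x α : ℝ} (hx : 0 ≤ x) (h0 : 0 < α)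
    (h1 : α < 1) : Integrable fun u : ℝ => Real.exp (-(x * Real.exp u)) * density α u := by
  refine (integrable_density h0 h1).bdd_mul (c := 1) (by fun_prop)
    (Eventually.of_forall fun u => ?_)
  rw [Real.norm_of_nonneg (Real.exp_pos _).le, Real.exp_le_one_iff]
  have := Real.exp_pos u
  simp only [Left.neg_nonpos_iff]
  positivity

/-- Far to the left the numerator is at most exp x in norm, while the denominator grows like
exp(-αB). -/
theorem tendsto_vertical_sumKernel {x α : ℝ} (hx : 0 < x) (h0 : 0 < α) :
    Tendsto (fun B => vertical B (sumKernel x α)) atBot (𝓝 0) := by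
  have ht : Tendsto (fun B : ℝ => Real.exp (-α * B) - 1) atBot atTop := by
    refine tendsto_atTop_add_const_right _ (-1) (Real.tendsto_exp_atTop.comp ?_)
    exact tendsto_id.const_mul_atBot_of_neg (neg_lt_zero.2 h0)
  refine tendsto_vertical_atBot
    (b := fun B => Real.exp x / (Real.exp (-α * B) - 1)) (ht.const_div_atTop _) ?_
  filter_upwards [eventually_lt_atBot 0] with B hB θ _
  have hE : 1 < Real.exp (-α * B) := Real.one_lt_exp_iff.2 (by nlinarith)
  rw [sumKernel, norm_div]
  refine div_le_div₀ (Real.exp_pos x).le ?_ (by linarith) ?_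
  · rw [Complex.norm_exp]
    refine Real.exp_le_exp.2 ?_
    simp only [Complex.exp_re, Complex.add_re, Complex.ofReal_re,
      Complex.mul_re, Complex.I_re, mul_zero, Complex.ofReal_im, Complex.I_im, mul_one, sub_self,
      add_zero]
    have h2 : Real.exp B * Real.cos (B + θ * Complex.I).im ≤ 1 := by
      have := Real.exp_le_one_iff.2 hB.le
      nlinarith [Real.cos_le_one (B + θ * Complex.I).im, Real.exp_pos B]
    nlinarith
  · have h3 := norm_sub_norm_le (Complex.exp (-α * (B + θ * Complex.I))) (-1)
    rw [norm_neg, norm_one, sub_neg_eq_add, add_comm _ (1 : ℂ), Complex.norm_exp] at h3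
    simpa using h3

/-- The function `x ↦ E_α(-x ^ α)` is a Laplace transform. -/
theorem mittagLeffler_eq_integral {x α : ℝ} (hx : 0 < x) (h0 : 0 < α) (h1 : α < 1) :
    mittagLeffler α (-(x ^ α)) = ∫ u, Real.exp (-(x * Real.exp u)) * density α u := by
  have hint : Integrable (jump (sumKernel x α)) := by
    refine (((integrable_exp_neg_mul_exp_mul_density hx.le h0 h1).ofReal (𝕜 := ℂ)).const_mul
      (2 * π * Complex.I)).congr (Eventually.of_forall fun u => ?_)
    simp only [jump_sumKernel x h0 h1 u]
    norm_cast
  -- Any positive abscissa would serve in place of 1.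
  have h := hankel_eq_integral (differentiableOn_sumKernel x h0 h1) hint
    (tendsto_vertical_sumKernel hx h0) 1
  rw [hankel_sumKernel hx h0 one_pos] at h
  simp_rw [jump_sumKernel x h0 h1] at h
  rw [integral_const_mul, integral_complex_ofReal] at h
  have hne : (2 * π * Complex.I : ℂ) ≠ 0 := by simp [Real.pi_ne_zero]
  exact_mod_cast mul_left_cancel₀ hne h

/-! ### Consequences at x = 0, total mass and monotonicity -/

theorem mittagLeffler_zero {α : ℝ} : mittagLeffler α 0 = 1 := by
  rw [mittagLeffler, tsum_eq_single 0 fun n hn => by simp [hn]]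
  simp

theorem continuous_mittagLeffler {α : ℝ} (h0 : 0 < α) : Continuous (mittagLeffler α) := by
  refine continuous_iff_continuousAt.2 fun x => ?_
  have h : ContinuousOn (mittagLeffler α) (Metric.ball 0 (|x| + 1)) := by
    refine continuousOn_tsum (fun n => by fun_prop) (mittagLeffler_summable h0 (|x| + 1)) ?_
    intro n y hy
    have hG : 0 < Real.Gamma (1 + n * α) := Real.Gamma_pos_of_pos (by positivity)
    rw [norm_div, norm_pow, Real.norm_of_nonneg hG.le]
    have : ‖y‖ ≤ |x| + 1 := by simpa using (mem_ball_zero_iff.1 hy).le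
    gcongr
  exact h.continuousAt (Metric.isOpen_ball.mem_nhds (by simp))

theorem continuous_mittagLeffler_neg_rpow {α : ℝ} (h0 : 0 < α) :
    Continuous fun x : ℝ => mittagLeffler α (-(x ^ α)) :=
  (continuous_mittagLeffler h0).comp (Real.continuous_rpow_const h0.le).neg

/-- The mass is read off by letting x → 0⁺ in the Laplace representation, since E_α(0) = 1. -/
theorem integral_density {α : ℝ} (h0 : 0 < α) (h1 : α < 1) : ∫ u, density α u = 1 := by
  have hF : Tendsto (fun x : ℝ => mittagLeffler α (-(x ^ α))) (𝓝[>] 0) (𝓝 1) := by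
    have := ((continuous_mittagLeffler_neg_rpow h0).tendsto 0).mono_left
      (nhdsWithin_le_nhds (s := Ioi 0))
    simpa [Real.zero_rpow h0.ne', mittagLeffler_zero] using this
  have hI : Tendsto (fun x : ℝ => ∫ u, Real.exp (-(x * Real.exp u)) * density α u) (𝓝[>] 0)
      (𝓝 (∫ u, density α u)) := by
    refine tendsto_integral_filter_of_dominated_convergence (density α) ?_ ?_
      (integrable_density h0 h1) ?_
    · filter_upwards [self_mem_nhdsWithin] with x hx
      exact (integrable_exp_neg_mul_exp_mul_density (mem_Ioi.1 hx).le h0 h1).aestronglyMeasurable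
    · filter_upwards [self_mem_nhdsWithin] with x hx
      refine Eventually.of_forall fun u => ?_
      have hd := density_pos h0 h1 u
      rw [Real.norm_of_nonneg (by positivity)]
      refine mul_le_of_le_one_left hd.le (Real.exp_le_one_iff.2 ?_)
      have := mul_pos (mem_Ioi.1 hx) (Real.exp_pos u)
      linarith
    · refine Eventually.of_forall fun u => ?_
      have : Continuous fun x : ℝ => Real.exp (-(x * Real.exp u)) * density α u := by fun_prop
      simpa using (this.tendsto 0).mono_left (nhdsWithin_le_nhds (s := Ioi 0))
  refine tendsto_nhds_unique (hI.congr' ?_) hF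
  filter_upwards [self_mem_nhdsWithin] with x hx
  rw [mittagLeffler_eq_integral hx h0 h1]

theorem mittagLeffler_eq_integral_of_nonneg {x α : ℝ} (hx : 0 ≤ x) (h0 : 0 < α) (h1 : α < 1) :
    mittagLeffler α (-(x ^ α)) = ∫ u, Real.exp (-(x * Real.exp u)) * density α u := by
  rcases eq_or_lt_of_le hx with rfl | hx
  · simp [Real.zero_rpow h0.ne', mittagLeffler_zero, integral_density h0 h1]
  · exact mittagLeffler_eq_integral hx h0 h1

/-- Strict positivity on a half-line suffices, which suits integrands that vanish at ±u₀. -/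
theorem integral_pos_of_forall_gt {f : ℝ → ℝ} (hf : Integrable f) (h0 : ∀ u, 0 ≤ f u) (c : ℝ)
    (hc : ∀ u, c < u → 0 < f u) : 0 < ∫ u, f u := by
  rw [integral_pos_iff_support_of_nonneg h0 hf]
  refine lt_of_lt_of_le ?_ (measure_mono fun u (hu : u ∈ Ioi c) => (hc u hu).ne')
  simp

theorem strictAntiOn_mittagLeffler_neg_rpow {α : ℝ} (h0 : 0 < α) (h1 : α < 1) :
    StrictAntiOn (fun x : ℝ => mittagLeffler α (-(x ^ α))) (Ici 0) := by
  intro x hx y hy hxy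
  simp only
  rw [mittagLeffler_eq_integral_of_nonneg hx h0 h1, mittagLeffler_eq_integral_of_nonneg hy h0 h1,
    ← sub_pos, ← integral_sub (integrable_exp_neg_mul_exp_mul_density hx h0 h1)
      (integrable_exp_neg_mul_exp_mul_density hy h0 h1)]
  have hpos : ∀ u : ℝ, 0 < Real.exp (-(x * Real.exp u)) * density α u -
      Real.exp (-(y * Real.exp u)) * density α u := by
    intro u
    rw [← sub_mul]
    refine mul_pos (sub_pos.2 (Real.exp_lt_exp.2 ?_)) (density_pos h0 h1 u)
    exact neg_lt_neg (mul_lt_mul_of_pos_right hxy (Real.exp_pos u))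
  exact integral_pos_of_forall_gt ((integrable_exp_neg_mul_exp_mul_density hx h0 h1).sub
    (integrable_exp_neg_mul_exp_mul_density hy h0 h1)) (fun u => (hpos u).le) 0
    fun u _ => hpos u

/-! ### Sign pattern of the difference of two densities -/

/-- The numerator of `density α u - density β u`. -/
noncomputable def densityGap (α β u : ℝ) : ℝ :=
  Real.sin (π * α) * (2 * Real.cosh (β * u) + 2 * Real.cos (π * β)) -
    Real.sin (π * β) * (2 * Real.cosh (α * u) + 2 * Real.cos (π * α))

theorem density_eq_cosh (α u : ℝ) :
    density α u = Real.sin (π * α) / (π * (2 * Real.cosh (α * u) + 2 * Real.cos (π * α))) := by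
  rw [density, Real.cosh_eq]; ring_nf

theorem density_sub_density {α β : ℝ} (ha : 0 < α) (ha1 : α < 1) (hb : 0 < β) (hb1 : β < 1)
    (u : ℝ) : ∃ c, 0 < c ∧ density α u - density β u = c * densityGap α β u := by
  have hA : 0 < 2 * Real.cosh (α * u) + 2 * Real.cos (π * α) := by
    have := density_denom_pos ha ha1 u
    rw [Real.cosh_eq]; linarith
  have hB : 0 < 2 * Real.cosh (β * u) + 2 * Real.cos (π * β) := by
    have := density_denom_pos hb hb1 u
    rw [Real.cosh_eq]; linarith
  refine ⟨1 / (π * (2 * Real.cosh (α * u) + 2 * Real.cos (π * α)) *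
    (2 * Real.cosh (β * u) + 2 * Real.cos (π * β))), by positivity, ?_⟩
  rw [density_eq_cosh, density_eq_cosh, densityGap, div_sub_div _ _ (by positivity)
    (by positivity), div_mul_eq_mul_div, div_eq_div_iff (by positivity) (by positivity)]
  ring

theorem densityGap_neg (α β u : ℝ) : densityGap α β (-u) = densityGap α β u := by
  simp [densityGap]

/-- The derivative is positive because sin(πα)/α > sin(πβ)/β, by concavity of the sine, and because
sinh is increasing. -/
theorem strictMonoOn_densityGap {α β : ℝ} (ha : 0 < α) (hab : α < β) (hb1 : β < 1) :
    StrictMonoOn (densityGap α β) (Ici 0) := by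
  have hb : 0 < β := ha.trans hab
  have hsin : α * Real.sin (π * β) < β * Real.sin (π * α) := by
    have h := strictConcaveOn_sin_Icc.2 (⟨le_rfl, Real.pi_pos.le⟩ : (0 : ℝ) ∈ Icc 0 π)
      (⟨by positivity, by nlinarith [Real.pi_pos]⟩ : π * β ∈ Icc 0 π) (by positivity)
      (show 0 < 1 - α / β by rw [sub_pos, div_lt_one hb]; exact hab)
      (show 0 < α / β by positivity) (by ring)
    have e : α / β * (π * β) = π * α := by field_simp
    simp only [smul_eq_mul, Real.sin_zero, mul_zero, zero_add, e] at h
    rw [div_mul_eq_mul_div, div_lt_iff₀ hb] at h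
    linarith
  have hd : ∀ u, HasDerivAt (densityGap α β)
      (2 * (β * Real.sin (π * α) * Real.sinh (β * u) -
        α * Real.sin (π * β) * Real.sinh (α * u))) u := by
    intro u
    have h : ∀ γ : ℝ, HasDerivAt (fun u : ℝ => Real.cosh (γ * u)) (Real.sinh (γ * u) * γ) u :=
      fun γ => by simpa using ((hasDerivAt_id u).const_mul γ).cosh
    have := ((((h β).const_mul 2).add_const (2 * Real.cos (π * β))).const_mul
      (Real.sin (π * α))).sub ((((h α).const_mul 2).add_const (2 * Real.cos (π * α))).const_mul
      (Real.sin (π * β)))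
    exact this.congr_deriv (by ring)
  refine strictMonoOn_of_deriv_pos (convex_Ici 0)
    (fun u _ => (hd u).continuousAt.continuousWithinAt) fun u hu => ?_
  rw [interior_Ici, mem_Ioi] at hu
  rw [(hd u).deriv]
  have h1 : 0 < Real.sinh (α * u) := Real.sinh_pos_iff.2 (by positivity)
  have h2 : Real.sinh (α * u) < Real.sinh (β * u) := Real.sinh_lt_sinh.2 (by nlinarith)
  have h3 := sin_pi_mul_pos ha (hab.trans hb1)
  have h4 : α * Real.sin (π * β) * Real.sinh (α * u) <
      β * Real.sin (π * α) * Real.sinh (α * u) := mul_lt_mul_of_pos_right hsin h1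
  have h5 : β * Real.sin (π * α) * Real.sinh (α * u) <
      β * Real.sin (π * α) * Real.sinh (β * u) := mul_lt_mul_of_pos_left h2 (by positivity)
  linarith

theorem integral_density_sub {α β : ℝ} (ha : 0 < α) (hab : α < β) (hb1 : β < 1) :
    ∫ u, (density α u - density β u) = 0 := by
  rw [integral_sub (integrable_density ha (hab.trans hb1))
    (integrable_density (ha.trans hab) hb1), integral_density ha (hab.trans hb1),
    integral_density (ha.trans hab) hb1, sub_self]

/-- The difference of two densities changes sign exactly at two opposite points. -/
theorem exists_density_crossing {α β : ℝ} (ha : 0 < α) (hab : α < β) (hb1 : β < 1) :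
    ∃ u₀ > 0, (∀ u, |u| < u₀ → density α u - density β u < 0) ∧
      ∀ u, u₀ < |u| → 0 < density α u - density β u := by
  have ha1 := hab.trans hb1
  have hb := ha.trans hab
  have hmono := strictMonoOn_densityGap ha hab hb1
  have habs : ∀ u, densityGap α β |u| = densityGap α β u := fun u => by
    rcases abs_choice u with h | h <;> rw [h]
    exact densityGap_neg α β u
  have hint := (integrable_density ha ha1).sub (integrable_density hb hb1)
  have hzero := integral_density_sub ha hab hb1
  have hcont : Continuous (densityGap α β) := by unfold densityGap; fun_prop
  -- A gap of constant sign on [0, ∞) would contradict the zero integral. This gives a negative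
  -- value at 0 and, next, a positive value somewhere.
  have hneg : densityGap α β 0 < 0 := by
    by_contra! h
    refine (integral_pos_of_forall_gt hint (fun u => ?_) 0 fun u hu => ?_).ne' hzero
    all_goals obtain ⟨c, hc, e⟩ := density_sub_density ha ha1 hb hb1 u
    · simp only [Pi.sub_apply]
      rw [e, ← habs]
      exact mul_nonneg hc.le (h.trans (hmono.monotoneOn self_mem_Ici (abs_nonneg u)
        (abs_nonneg u)))
    · simp only [Pi.sub_apply]
      rw [e]
      exact mul_pos hc (h.trans_lt (hmono self_mem_Ici (mem_Ici.2 hu.le) hu))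
  obtain ⟨v, hv0, hv⟩ : ∃ v, 0 ≤ v ∧ 0 < densityGap α β v := by
    by_contra! h
    have hlt : ∀ u, 0 < -(density α u - density β u) := by
      intro u
      obtain ⟨c, hc, e⟩ := density_sub_density ha ha1 hb hb1 u
      rw [e, ← habs, ← mul_neg]
      have h1 := hmono (abs_nonneg u) (mem_Ici.2 (by positivity : 0 ≤ |u| + 1)) (lt_add_one _)
      have h2 := h (|u| + 1) (by positivity)
      exact mul_pos hc (by linarith)
    have := integral_pos_of_forall_gt hint.neg (fun u => (hlt u).le) 0 fun u _ => hlt u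
    simp only [Pi.neg_apply, Pi.sub_apply, integral_neg, hzero] at this
    simp at this
  obtain ⟨u₀, ⟨hu0, -⟩, he⟩ := intermediate_value_Icc hv0 hcont.continuousOn
    (show (0 : ℝ) ∈ Icc _ _ from ⟨hneg.le, hv.le⟩)
  refine ⟨u₀, lt_of_le_of_ne hu0 ?_, fun u hu => ?_, fun u hu => ?_⟩
  · rintro rfl
    exact hneg.ne he
  · obtain ⟨c, hc, e⟩ := density_sub_density ha ha1 hb hb1 u
    rw [e, ← habs]
    have := hmono (abs_nonneg u) hu0 hu
    exact mul_neg_of_pos_of_neg hc (by linarith)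
  · obtain ⟨c, hc, e⟩ := density_sub_density ha ha1 hb hb1 u
    rw [e, ← habs]
    have := hmono hu0 (abs_nonneg u) hu
    exact mul_pos hc (by linarith)

theorem integrable_exp_mul_density_sub {α β x : ℝ} (ha : 0 < α) (hab : α < β) (hb1 : β < 1)
    (hx : 0 ≤ x) :
    Integrable fun u => Real.exp (-(x * Real.exp u)) * (density α u - density β u) := by
  simp only [mul_sub]
  exact (integrable_exp_neg_mul_exp_mul_density hx ha (hab.trans hb1)).sub
    (integrable_exp_neg_mul_exp_mul_density hx (ha.trans hab) hb1)

theorem mittagLeffler_sub_eq_integral {α β x : ℝ} (ha : 0 < α) (hab : α < β) (hb1 : β < 1)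
    (hx : 0 ≤ x) :
    mittagLeffler α (-(x ^ α)) - mittagLeffler β (-(x ^ β)) =
      ∫ u, Real.exp (-(x * Real.exp u)) * (density α u - density β u) := by
  rw [mittagLeffler_eq_integral_of_nonneg hx ha (hab.trans hb1),
    mittagLeffler_eq_integral_of_nonneg hx (ha.trans hab) hb1,
    ← integral_sub (integrable_exp_neg_mul_exp_mul_density hx ha (hab.trans hb1))
      (integrable_exp_neg_mul_exp_mul_density hx (ha.trans hab) hb1)]
  simp only [mul_sub]

/-! ### Variation diminishing and the sign at x = 1 -/

theorem strictConvexOn_sub_chord {s : Set ℝ} {φ : ℝ → ℝ} (hφ : StrictConvexOn ℝ s φ) {a b v : ℝ}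
    (ha : a ∈ s) (hb : b ∈ s) (hv : v ∈ s) (hab : a < b) :
    (v < a → 0 < φ v - φ a - (φ b - φ a) / (b - a) * (v - a)) ∧
    (a < v → v < b → φ v - φ a - (φ b - φ a) / (b - a) * (v - a) < 0) ∧
    (b < v → 0 < φ v - φ a - (φ b - φ a) / (b - a) * (v - a)) := by
  refine ⟨fun h => ?_, fun h h' => ?_, fun h => ?_⟩
  · have := hφ.secant_strict_mono ha hv hb h.ne hab.ne' (h.trans hab)
    rw [div_lt_iff_of_neg (by linarith)] at this
    linarith
  · have := hφ.secant_strict_mono ha hv hb h.ne' hab.ne' h'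
    rw [div_lt_iff₀ (by linarith)] at this
    linarith
  · have := hφ.secant_strict_mono ha hb hv hab.ne' (hab.trans h).ne' h
    rw [lt_div_iff₀ (by linarith)] at this
    linarith

/-- Variation diminishing: once nonnegative, the difference of the two functions stays positive. -/
theorem mittagLeffler_sub_pos_of_lt {α β x y : ℝ} (ha : 0 < α) (hab : α < β) (hb1 : β < 1)
    (hx : 0 < x) (hxy : x < y)
    (h : 0 ≤ mittagLeffler α (-(x ^ α)) - mittagLeffler β (-(x ^ β))) :
    0 < mittagLeffler α (-(y ^ α)) - mittagLeffler β (-(y ^ β)) := by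
  obtain ⟨u₀, hu0, hneg, hpos⟩ := exists_density_crossing ha hab hb1
  set v : ℝ → ℝ := fun u => Real.exp (-(x * Real.exp u)) with hv
  have hvanti : StrictAnti v := fun s t hst =>
    Real.exp_lt_exp.2 (neg_lt_neg (mul_lt_mul_of_pos_left (Real.exp_lt_exp.2 hst) hx))
  -- φ carries exp(-x e^u) to exp(-y e^u), and it is strictly convex since y/x > 1.
  set φ : ℝ → ℝ := fun t => t ^ (y / x) with hφ
  have hconv : StrictConvexOn ℝ (Ici 0) φ := strictConvexOn_rpow ((one_lt_div hx).2 hxy)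
  have hmem : ∀ u, v u ∈ Ici (0 : ℝ) := fun u => (Real.exp_pos _).le
  have hφv : ∀ u, φ (v u) = Real.exp (-(y * Real.exp u)) := fun u => by
    simp only [hφ, hv, ← Real.exp_mul]
    congr 1
    field_simp
  have hlt : v u₀ < v (-u₀) := hvanti (by linarith)
  set m := (φ (v (-u₀)) - φ (v u₀)) / (v (-u₀) - v u₀) with hm
  have hm0 : 0 < m := by
    refine div_pos (sub_pos.2 ?_) (sub_pos.2 hlt)
    exact Real.rpow_lt_rpow (hmem _) hlt (by have := hx.trans hxy; positivity)
  -- The chord through the values at ±u₀ makes φ minus chord change sign exactly where the density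
  -- difference does.
  have hP : ∀ u, |u| ≠ u₀ → 0 < (φ (v u) - φ (v u₀) - m * (v u - v u₀)) *
      (density α u - density β u) := by
    intro u hu
    obtain ⟨h1, h2, h3⟩ := strictConvexOn_sub_chord hconv (hmem u₀) (hmem (-u₀)) (hmem u) hlt
    rcases lt_or_gt_of_ne hu with hu | hu
    · exact mul_pos_of_neg_of_neg (h2 (hvanti (abs_lt.1 hu).2) (hvanti (abs_lt.1 hu).1))
        (hneg u hu)
    · refine mul_pos ?_ (hpos u hu)
      rcases lt_abs.1 hu with hu | hu
      · exact h1 (hvanti hu)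
      · exact h3 (hvanti (by linarith))
  have hP0 : ∀ u, 0 ≤ (φ (v u) - φ (v u₀) - m * (v u - v u₀)) *
      (density α u - density β u) := by
    intro u
    by_cases hu : |u| = u₀
    · rcases eq_or_eq_neg_of_abs_eq hu with rfl | rfl
      · simp
      · rw [hm, div_mul_cancel₀ _ (sub_pos.2 hlt).ne']
        simp
    · exact (hP u hu).le
  have hix := integrable_exp_mul_density_sub ha hab hb1 hx.le
  have hiy := integrable_exp_mul_density_sub ha hab hb1 (hx.trans hxy).le
  have hi0 : Integrable fun u => density α u - density β u :=
    (integrable_density ha (hab.trans hb1)).sub (integrable_density (ha.trans hab) hb1)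
  have hc : Integrable fun u => Real.exp (-(y * Real.exp u)) * (density α u - density β u) -
      m * (Real.exp (-(x * Real.exp u)) * (density α u - density β u)) :=
    hiy.sub (hix.const_mul _)
  have e : (fun u => (φ (v u) - φ (v u₀) - m * (v u - v u₀)) * (density α u - density β u)) =
      fun u => (Real.exp (-(y * Real.exp u)) * (density α u - density β u) -
        m * (Real.exp (-(x * Real.exp u)) * (density α u - density β u))) -
        (φ (v u₀) - m * v u₀) * (density α u - density β u) := by
    funext u
    rw [hφv]
    simp only [hv]
    ring
  have key := integral_pos_of_forall_gt (f := fun u =>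
    (φ (v u) - φ (v u₀) - m * (v u - v u₀)) * (density α u - density β u))
    (by rw [e]; exact hc.sub (hi0.const_mul _)) hP0 u₀
    fun u hu => hP u (by rw [abs_of_pos (hu0.trans hu)]; exact hu.ne')
  -- Constants integrate to zero against the density difference, so f(y) - m f(x) > 0 with slope m >
  -- 0.
  rw [e, integral_sub hc (hi0.const_mul _),
    integral_sub hiy (hix.const_mul _), integral_const_mul, integral_const_mul,
    integral_density_sub ha hab hb1, ← mittagLeffler_sub_eq_integral ha hab hb1 hx.le,
    ← mittagLeffler_sub_eq_integral ha hab hb1 (hx.trans hxy).le] at key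
  have := mul_nonneg hm0.le h
  linarith

/-- Comparing the two exponents in the derivative reduces the claim to u < sinh u. -/
theorem strictMonoOn_exp_neg_exp_add :
    StrictMonoOn (fun u : ℝ => Real.exp (-Real.exp u) + Real.exp (-Real.exp (-u))) (Ici 0) := by
  have hd : ∀ u : ℝ, HasDerivAt
      (fun u : ℝ => Real.exp (-Real.exp u) + Real.exp (-Real.exp (-u)))
      (Real.exp (-u - Real.exp (-u)) - Real.exp (u - Real.exp u)) u := by
    intro u
    have h1 := (Real.hasDerivAt_exp u).neg.exp
    have h2 := ((hasDerivAt_id u).neg.exp).neg.exp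
    refine (h1.add h2).congr_deriv ?_
    simp only [sub_eq_add_neg, Real.exp_add, Pi.neg_apply, id]
    ring
  refine strictMonoOn_of_deriv_pos (convex_Ici 0)
    (fun u _ => (hd u).continuousAt.continuousWithinAt) fun u hu => ?_
  rw [interior_Ici, mem_Ioi] at hu
  rw [(hd u).deriv, sub_pos, Real.exp_lt_exp]
  have := Real.self_lt_sinh_iff.2 hu
  rw [Real.sinh_eq] at this
  linarith

/-- Since the densities are even, exp(-e^u) may be symmetrized to ψ, increasing in |u|; ψ - ψ(u₀)
then has the sign of the density difference, and its integral against it is 2f(1). -/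
theorem mittagLeffler_sub_pos_one {α β : ℝ} (ha : 0 < α) (hab : α < β) (hb1 : β < 1) :
    0 < mittagLeffler α (-((1 : ℝ) ^ α)) - mittagLeffler β (-((1 : ℝ) ^ β)) := by
  obtain ⟨u₀, hu0, hneg, hpos⟩ := exists_density_crossing ha hab hb1
  set ψ : ℝ → ℝ := fun u => Real.exp (-Real.exp u) + Real.exp (-Real.exp (-u)) with hψ
  have hmono : StrictMonoOn ψ (Ici 0) := strictMonoOn_exp_neg_exp_add
  have hψabs : ∀ u, ψ |u| = ψ u := fun u => by
    rcases abs_choice u with h | h <;> rw [h]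
    simp only [hψ, neg_neg]
    ring
  have hP : ∀ u, |u| ≠ u₀ → 0 < (ψ u - ψ u₀) * (density α u - density β u) := by
    intro u hu
    rw [← hψabs]
    rcases lt_or_gt_of_ne hu with hu | hu
    · exact mul_pos_of_neg_of_neg (sub_neg.2 (hmono (abs_nonneg u) hu0.le hu)) (hneg u hu)
    · exact mul_pos (sub_pos.2 (hmono hu0.le (abs_nonneg u) hu)) (hpos u hu)
  have hP0 : ∀ u, 0 ≤ (ψ u - ψ u₀) * (density α u - density β u) := by
    intro u
    by_cases hu : |u| = u₀
    · rw [← hψabs, hu]; simp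
    · exact (hP u hu).le
  have hi := integrable_exp_mul_density_sub ha hab hb1 zero_le_one
  have hi0 : Integrable fun u => density α u - density β u :=
    (integrable_density ha (hab.trans hb1)).sub (integrable_density (ha.trans hab) hb1)
  have hc : Integrable fun u => Real.exp (-(1 * Real.exp u)) * (density α u - density β u) +
      Real.exp (-(1 * Real.exp (-u))) * (density α (-u) - density β (-u)) :=
    hi.add hi.comp_neg
  have e : (fun u => (ψ u - ψ u₀) * (density α u - density β u)) =
      fun u => (Real.exp (-(1 * Real.exp u)) * (density α u - density β u) +
        Real.exp (-(1 * Real.exp (-u))) * (density α (-u) - density β (-u))) -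
        ψ u₀ * (density α u - density β u) := by
    funext u
    rw [density_neg, density_neg]
    simp only [hψ, one_mul]
    ring
  have key := integral_pos_of_forall_gt (f := fun u => (ψ u - ψ u₀) * (density α u - density β u))
    (by rw [e]; exact hc.sub (hi0.const_mul _)) hP0 u₀
    fun u hu => hP u (by rw [abs_of_pos (hu0.trans hu)]; exact hu.ne')
  rw [e, integral_sub hc (hi0.const_mul _), integral_add hi hi.comp_neg,
    integral_neg_eq_self (fun u => Real.exp (-(1 * Real.exp u)) * (density α u - density β u)),
    integral_const_mul, integral_density_sub ha hab hb1,
    ← mittagLeffler_sub_eq_integral ha hab hb1 zero_le_one] at key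
  linarith

/-! ### Fractional integrals and the Volterra equation -/

theorem intervalIntegrable_sub_rpow {c : ℝ} (hc : 0 < c) (x a b : ℝ) :
    IntervalIntegrable (fun y : ℝ => (x - y) ^ (c - 1)) volume a b := by
  have := (intervalIntegral.intervalIntegrable_rpow' (a := x - a) (b := x - b)
    (by linarith : -1 < c - 1)).comp_sub_left x
  simpa using this

theorem integral_sub_rpow {c x : ℝ} (hc : 0 < c) : ∫ y in (0 : ℝ)..x, (x - y) ^ (c - 1) =
    x ^ c / c := by
  rw [intervalIntegral.integral_comp_sub_left (fun t : ℝ => t ^ (c - 1)), sub_self, sub_zero,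
    integral_rpow (Or.inl (by linarith))]
  simp [Real.zero_rpow hc.ne']

/-- Euler's Beta integral, rescaled to (0, x). -/
theorem integral_sub_rpow_mul_rpow {c p x : ℝ} (hc : 0 < c) (hp : -1 < p) (hx : 0 < x) :
    ∫ y in (0 : ℝ)..x, (x - y) ^ (c - 1) * y ^ p =
      Real.Gamma c * Real.Gamma (1 + p) * x ^ (p + c) / Real.Gamma (1 + p + c) := by
  have h := Complex.betaIntegral_scaled ((1 + p : ℝ) : ℂ) (c : ℂ) hx
  have hG := Complex.Gamma_mul_Gamma_eq_betaIntegral (s := ((1 + p : ℝ) : ℂ)) (t := (c : ℂ))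
    (by simpa using by linarith) (by simpa using hc)
  have e : ∫ y in (0 : ℝ)..x, (y : ℂ) ^ (((1 + p : ℝ) : ℂ) - 1) * ((x : ℂ) - y) ^ ((c : ℂ) - 1) =
      ((∫ y in (0 : ℝ)..x, (x - y) ^ (c - 1) * y ^ p : ℝ) : ℂ) := by
    rw [← intervalIntegral.integral_ofReal]
    refine intervalIntegral.integral_congr fun y hy => ?_
    rw [uIcc_of_le hx.le] at hy
    rw [show ((1 + p : ℝ) : ℂ) - 1 = (p : ℂ) by push_cast; ring,
      show (c : ℂ) - 1 = ((c - 1 : ℝ) : ℂ) by push_cast; ring, ← Complex.ofReal_sub,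
      ← Complex.ofReal_cpow hy.1, ← Complex.ofReal_cpow (sub_nonneg.2 hy.2)]
    push_cast
    ring
  rw [e] at h
  have hne : Complex.Gamma (((1 + p : ℝ) : ℂ) + c) ≠ 0 := by
    rw [← Complex.ofReal_add, Complex.Gamma_ofReal]
    exact_mod_cast (Real.Gamma_pos_of_pos (by linarith)).ne'
  have hx' : (x : ℂ) ^ (((1 + p : ℝ) : ℂ) + c - 1) = ((x ^ (p + c) : ℝ) : ℂ) := by
    rw [Complex.ofReal_cpow hx.le]
    congr 1
    push_cast
    ring
  rw [hx'] at h
  have hB : Complex.betaIntegral ((1 + p : ℝ) : ℂ) c =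
      ((Real.Gamma (1 + p) * Real.Gamma c / Real.Gamma (1 + p + c) : ℝ) : ℂ) := by
    rw [eq_comm, ← mul_right_inj' hne, ← hG, ← Complex.ofReal_add, Complex.Gamma_ofReal,
      Complex.Gamma_ofReal, Complex.Gamma_ofReal, ← Complex.ofReal_mul, ← Complex.ofReal_mul,
      mul_div_cancel₀]
    exact (Real.Gamma_pos_of_pos (by linarith)).ne'
  rw [hB, ← Complex.ofReal_mul] at h
  rw [Complex.ofReal_injective h]
  ring

theorem neg_rpow_pow_div_gamma {y : ℝ} (hy : 0 ≤ y) (α : ℝ) (n : ℕ) :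
    (-(y ^ α)) ^ n / Real.Gamma (1 + n * α) =
      (-1) ^ n * (y ^ (n * α) / Real.Gamma (1 + n * α)) := by
  rw [neg_pow, ← Real.rpow_natCast (y ^ α) n, ← Real.rpow_mul hy, mul_comm α, mul_div_assoc]

/-- The fractional integrals of `x ↦ E_α(-x ^ α)`. -/
theorem hasSum_integral_sub_rpow_mul {α c x : ℝ} (h0 : 0 < α) (hc : 0 < c) (hx : 0 < x) :
    HasSum (fun n : ℕ => (-1) ^ n * (Real.Gamma c * x ^ (n * α + c) /
      Real.Gamma (1 + n * α + c)))
      (∫ y in (0 : ℝ)..x, (x - y) ^ (c - 1) * mittagLeffler α (-(y ^ α))) := by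
  have hG : ∀ n : ℕ, 0 < Real.Gamma (1 + n * α) := fun n => Real.Gamma_pos_of_pos (by positivity)
  have hI := intervalIntegrable_sub_rpow hc x 0 x
  have hs := mittagLeffler_summable h0 (x ^ α)
  have h := intervalIntegral.hasSum_integral_of_dominated_convergence
    (a := 0) (b := x) (μ := volume)
    (F := fun (n : ℕ) (y : ℝ) => (x - y) ^ (c - 1) *
      ((-(y ^ α)) ^ n / Real.Gamma (1 + n * α)))
    (f := fun y : ℝ => (x - y) ^ (c - 1) * mittagLeffler α (-(y ^ α)))
    (fun n y => (x - y) ^ (c - 1) * ((x ^ α) ^ n / Real.Gamma (1 + n * α))) ?_ ?_ ?_ ?_ ?_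
  · refine h.congr_fun fun n => ?_
    have e : ∫ y in (0 : ℝ)..x, (x - y) ^ (c - 1) * ((-(y ^ α)) ^ n / Real.Gamma (1 + n * α)) =
        ∫ y in (0 : ℝ)..x, ((-1) ^ n / Real.Gamma (1 + n * α)) *
          ((x - y) ^ (c - 1) * y ^ (n * α)) := by
      refine intervalIntegral.integral_congr fun y hy => ?_
      rw [uIcc_of_le hx.le] at hy
      rw [neg_rpow_pow_div_gamma hy.1]
      ring
    rw [e, intervalIntegral.integral_const_mul, integral_sub_rpow_mul_rpow hc
      (by linarith [show (0 : ℝ) ≤ n * α by positivity]) hx]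
    have := (hG n).ne'
    field_simp
  · intro n
    refine (hI.mul_continuousOn (Continuous.continuousOn ?_)).aestronglyMeasurable_restrict_uIoc
    exact (((Real.continuous_rpow_const h0.le).neg).pow n).div_const _
  · refine fun n => Eventually.of_forall fun y hy => ?_
    rw [uIoc_of_le hx.le] at hy
    rw [norm_mul, Real.norm_of_nonneg (Real.rpow_nonneg (sub_nonneg.2 hy.2) _), norm_div, norm_pow,
      norm_neg, Real.norm_of_nonneg (hG n).le, Real.norm_of_nonneg (Real.rpow_nonneg hy.1.le _)]
    have h1 := Real.rpow_nonneg (sub_nonneg.2 hy.2) (c - 1)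
    have h2 := hG n
    have h3 := hy.1.le
    gcongr
    exact hy.2
  · exact Eventually.of_forall fun y _ => hs.mul_left _
  · simp_rw [tsum_mul_left]
    exact hI.mul_const _
  · exact Eventually.of_forall fun y _ => (mittagLeffler_summable h0 (-(y ^ α))).hasSum.mul_left _

/-- The Volterra equation of `x ↦ E_α(-x ^ α)`. -/
theorem integral_sub_rpow_mul_mittagLeffler {α x : ℝ} (h0 : 0 < α) (hx : 0 < x) :
    ∫ y in (0 : ℝ)..x, (x - y) ^ (α - 1) * mittagLeffler α (-(y ^ α)) =
      Real.Gamma α * (1 - mittagLeffler α (-(x ^ α))) := by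
  refine (hasSum_integral_sub_rpow_mul h0 h0 hx).unique ?_
  -- For c = α, term n of the fractional integral is -Γ(α) times term n + 1 of the series of F_α.
  have h := (hasSum_nat_add_iff' 1).2 (mittagLeffler_summable h0 (-(x ^ α))).hasSum
  change HasSum _ (mittagLeffler α (-(x ^ α)) - _) at h
  simp only [Finset.range_one, Finset.sum_singleton, pow_zero, Nat.cast_zero, zero_mul, add_zero,
    Real.Gamma_one, div_one] at h
  have h2 := h.mul_left (-Real.Gamma α)
  rw [show -Real.Gamma α * (mittagLeffler α (-x ^ α) - 1) =
    Real.Gamma α * (1 - mittagLeffler α (-(x ^ α))) by ring] at h2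
  refine h2.congr_fun fun n => ?_
  rw [neg_rpow_pow_div_gamma hx.le]
  push_cast
  rw [pow_succ, show ((n : ℝ) + 1) * α = n * α + α by ring, ← add_assoc 1]
  ring

/-- At order 1 - α, term n + 1 of the fractional integral of F_α is -Γ(1-α) times term n of its
ordinary integral; the leading term is the integral of the kernel alone. -/
theorem integral_mittagLeffler_neg_rpow {α x : ℝ} (h0 : 0 < α) (h1 : α < 1) (hx : 0 < x) :
    ∫ y in (0 : ℝ)..x, (x - y) ^ (-α) * (1 - mittagLeffler α (-(y ^ α))) =
      Real.Gamma (1 - α) * ∫ y in (0 : ℝ)..x, mittagLeffler α (-(y ^ α)) := by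
  have hc : 0 < 1 - α := by linarith
  have hA := hasSum_integral_sub_rpow_mul h0 hc hx
  have hB := (hasSum_integral_sub_rpow_mul h0 one_pos hx).mul_left (-Real.Gamma (1 - α))
  have hI := intervalIntegrable_sub_rpow hc x 0 x
  rw [show (1 - α - 1) = -α by ring] at hA hI
  have hA' := (hasSum_nat_add_iff' 1).2 hA
  simp only [sub_self, Real.rpow_zero, one_mul] at hB
  have h := hA'.unique (hB.congr_fun fun n => ?_)
  · simp only [Finset.range_one, Finset.sum_singleton, pow_zero, Nat.cast_zero, zero_mul,
      zero_add, add_zero, one_mul] at h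
    simp only [mul_sub, mul_one]
    rw [intervalIntegral.integral_sub hI (hI.mul_continuousOn
      (continuous_mittagLeffler_neg_rpow h0).continuousOn)]
    have e := integral_sub_rpow (x := x) hc
    rw [show (1 - α - 1) = -α by ring] at e
    rw [add_comm 1 (1 - α), Real.Gamma_add_one hc.ne'] at h
    rw [e]
    have hG := (Real.Gamma_pos_of_pos hc).ne'
    rw [mul_comm (1 - α), mul_div_mul_left _ _ hG] at h
    linarith
  · push_cast
    rw [pow_succ, Real.Gamma_one, show ((n : ℝ) + 1) * α + (1 - α) = n * α + 1 by ring,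
      show 1 + ((n : ℝ) + 1) * α + (1 - α) = 1 + n * α + 1 by ring]
    ring

/-! ### Rational upper and lower bounds -/

/-- F_α is decreasing, so replacing F_α(y) by F_α(x) in the Volterra equation gives Γ(α)(1 - F_α(x))
> F_α(x) x^α/α. -/
theorem mittagLeffler_neg_rpow_lt {α x : ℝ} (h0 : 0 < α) (h1 : α < 1) (hx : 0 < x) :
    mittagLeffler α (-(x ^ α)) < 1 / (1 + x ^ α / Real.Gamma (1 + α)) := by
  have hI := intervalIntegrable_sub_rpow h0 x 0 x
  have hV := integral_sub_rpow_mul_mittagLeffler h0 hx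
  have hanti := strictAntiOn_mittagLeffler_neg_rpow h0 h1
  have hF := hI.mul_continuousOn (continuous_mittagLeffler_neg_rpow h0).continuousOn
  have hpos := intervalIntegral.intervalIntegral_pos_of_pos_on (f := fun y =>
    (x - y) ^ (α - 1) * mittagLeffler α (-(y ^ α)) -
      (x - y) ^ (α - 1) * mittagLeffler α (-(x ^ α)))
    (hF.sub (hI.mul_const _)) (fun y hy => ?_) hx
  · rw [intervalIntegral.integral_sub hF (hI.mul_const _), hV,
      intervalIntegral.integral_mul_const, integral_sub_rpow h0] at hpos
    have hG : 0 < Real.Gamma (1 + α) := Real.Gamma_pos_of_pos (by linarith)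
    have hG' : Real.Gamma (1 + α) = α * Real.Gamma α := by
      rw [add_comm, Real.Gamma_add_one h0.ne']
    rw [lt_div_iff₀ (by positivity), mul_add, mul_one, ← mul_div_assoc, ← lt_sub_iff_add_lt',
      div_lt_iff₀ hG, hG']
    rw [div_mul_eq_mul_div, sub_pos, div_lt_iff₀ h0] at hpos
    linarith
  · rw [← mul_sub]
    exact mul_pos (Real.rpow_pos_of_pos (sub_pos.2 hy.2) _)
      (sub_pos.2 (hanti hy.1.le hx.le hy.2))

/-- A finite-difference form of differentiating `integral_mittagLeffler_neg_rpow`: with g = 1 - F_α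
increasing from g(0) = 0, the derivative of the left side is ∫ (x-y)^(-α) dg(y) ≥ x^(-α) g(x).
Increments of length h avoid differentiating F_α. -/
theorem one_sub_mittagLeffler_le {α x h : ℝ} (h0 : 0 < α) (h1 : α < 1) (hx : 0 < x)
    (hh : 0 < h) :
    (x + h) ^ (-α) * (1 - mittagLeffler α (-(x ^ α))) ≤
      Real.Gamma (1 - α) * mittagLeffler α (-(x ^ α)) := by
  have hc : 0 < 1 - α := by linarith
  set F : ℝ → ℝ := fun y => mittagLeffler α (-(y ^ α)) with hF
  have hFc : Continuous F := continuous_mittagLeffler_neg_rpow h0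
  have hanti : AntitoneOn F (Ici 0) := (strictAntiOn_mittagLeffler_neg_rpow h0 h1).antitoneOn
  have hgc : Continuous fun y => 1 - F y := by fun_prop
  have hg : ∀ y, 0 ≤ y → 0 ≤ 1 - F y := fun y hy => by
    have := hanti self_mem_Ici hy hy
    simpa [hF, Real.zero_rpow h0.ne', mittagLeffler_zero] using this
  have hI : ∀ z a b : ℝ, IntervalIntegrable (fun y : ℝ => (z - y) ^ (-α)) volume a b := by
    intro z a b
    have := intervalIntegrable_sub_rpow hc z a b
    rwa [show (1 - α - 1) = -α by ring] at this
  have hIg : ∀ z a b : ℝ, IntervalIntegrable (fun y : ℝ => (z - y) ^ (-α) * (1 - F y))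
      volume a b := fun z a b => (hI z a b).mul_continuousOn hgc.continuousOn
  have hIgh : ∀ z a b : ℝ, IntervalIntegrable (fun y : ℝ => (z - y) ^ (-α) * (1 - F (y + h)))
      volume a b := fun z a b => (hI z a b).mul_continuousOn (by fun_prop)
  have hi : ∀ a b, IntervalIntegrable (fun y => 1 - F y) volume a b :=
    fun a b => hgc.intervalIntegrable _ _
  have hih : ∀ a b, IntervalIntegrable (fun y => 1 - F (y + h)) volume a b :=
    fun a b => Continuous.intervalIntegrable (by fun_prop) _ _
  have hFi : ∀ a b, IntervalIntegrable F volume a b := fun a b => hFc.intervalIntegrable _ _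
  have e1 := integral_mittagLeffler_neg_rpow h0 h1 hx
  have e2 := integral_mittagLeffler_neg_rpow h0 h1 (add_pos hx hh)
  -- Shifting y by h beyond the first piece aligns the kernel with the one at x, so that only
  -- increments of 1 - F remain.
  have s1 : ∫ y in (0 : ℝ)..(x + h), (x + h - y) ^ (-α) * (1 - F y) =
      (∫ y in (0 : ℝ)..h, (x + h - y) ^ (-α) * (1 - F y)) +
        ∫ y in (0 : ℝ)..x, (x - y) ^ (-α) * (1 - F (y + h)) := by
    rw [← intervalIntegral.integral_add_adjacent_intervals (hIg _ 0 h) (hIg _ h (x + h))]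
    congr 1
    have := intervalIntegral.integral_comp_add_right (a := 0) (b := x)
      (fun y => (x + h - y) ^ (-α) * (1 - F y)) h
    rw [zero_add] at this
    rw [← this]
    simp only [add_sub_add_right_eq_sub]
  have s2 : (∫ y in (0 : ℝ)..x, (1 - F (y + h))) = ∫ y in h..(x + h), (1 - F y) := by
    have := intervalIntegral.integral_comp_add_right (a := 0) (b := x) (fun y => 1 - F y) h
    rwa [zero_add] at this
  have b1 : (x + h) ^ (-α) * (∫ y in (0 : ℝ)..h, (1 - F y)) ≤
      ∫ y in (0 : ℝ)..h, (x + h - y) ^ (-α) * (1 - F y) := by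
    rw [← intervalIntegral.integral_const_mul]
    refine intervalIntegral.integral_mono_on_of_le_Ioo hh.le ((hi _ _).const_mul _) (hIg _ _ _)
      fun y hy => mul_le_mul_of_nonneg_right ?_ (hg y hy.1.le)
    exact Real.rpow_le_rpow_of_nonpos (by linarith [hy.2]) (by linarith [hy.1]) (by linarith)
  have b2 : (x + h) ^ (-α) * (∫ y in (0 : ℝ)..x, ((1 - F (y + h)) - (1 - F y))) ≤
      ∫ y in (0 : ℝ)..x, ((x - y) ^ (-α) * (1 - F (y + h)) - (x - y) ^ (-α) * (1 - F y)) := by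
    rw [← intervalIntegral.integral_const_mul]
    refine intervalIntegral.integral_mono_on_of_le_Ioo hx.le
      (((hih _ _).sub (hi _ _)).const_mul _) ((hIgh _ _ _).sub (hIg _ _ _)) fun y hy => ?_
    rw [← mul_sub]
    refine mul_le_mul_of_nonneg_right ?_ ?_
    · exact Real.rpow_le_rpow_of_nonpos (by linarith [hy.2]) (by linarith [hy.1]) (by linarith)
    · have := hanti (mem_Ici.2 hy.1.le) (mem_Ici.2 (by linarith [hy.1] : 0 ≤ y + h))
        (by linarith)
      linarith
  rw [intervalIntegral.integral_sub (hih _ _) (hi _ _), s2,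
    intervalIntegral.integral_sub (hIgh _ _ _) (hIg _ _ _)] at b2
  have a1 := intervalIntegral.integral_add_adjacent_intervals (hi 0 h) (hi h (x + h))
  have a2 := intervalIntegral.integral_add_adjacent_intervals (hi 0 x) (hi x (x + h))
  have a3 := intervalIntegral.integral_add_adjacent_intervals (hFi 0 x) (hFi x (x + h))
  have c1 : h * (1 - F x) ≤ ∫ y in x..(x + h), (1 - F y) := by
    have := intervalIntegral.integral_mono_on (f := fun _ => 1 - F x) (by linarith) (by simp)
      (hi x (x + h)) fun y hy => by
        have := hanti hx.le (hx.le.trans hy.1) hy.1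
        linarith
    rwa [intervalIntegral.integral_const, add_sub_cancel_left, smul_eq_mul] at this
  have c2 : ∫ y in x..(x + h), F y ≤ h * F x := by
    have := intervalIntegral.integral_mono_on (g := fun _ => F x) (by linarith)
      (hFi x (x + h)) (by simp) fun y hy => hanti hx.le (hx.le.trans hy.1) hy.1
    simpa using this
  have hG := Real.Gamma_pos_of_pos hc
  have hp : 0 < (x + h) ^ (-α) := Real.rpow_pos_of_pos (by linarith) _
  have d1 := mul_le_mul_of_nonneg_left c1 hp.le
  have d2 := mul_le_mul_of_nonneg_left c2 hG.le
  change _ = Real.Gamma (1 - α) * ∫ y in (0 : ℝ)..x, F y at e1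
  change (∫ y in (0 : ℝ)..(x + h), (x + h - y) ^ (-α) * (1 - F y)) =
    Real.Gamma (1 - α) * ∫ y in (0 : ℝ)..(x + h), F y at e2
  rw [s1, ← a3, mul_add] at e2
  have a4 : (∫ y in (0 : ℝ)..h, (1 - F y)) + ((∫ y in h..(x + h), (1 - F y)) -
    ∫ y in (0 : ℝ)..x, (1 - F y)) = ∫ y in x..(x + h), (1 - F y) := by linarith
  rw [← a4, mul_add] at d1
  refine le_of_mul_le_mul_left (a := h) ?_ hh
  linarith

theorem le_mittagLeffler_neg_rpow {α x : ℝ} (h0 : 0 < α) (h1 : α < 1) (hx : 0 < x) :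
    1 / (1 + Real.Gamma (1 - α) * x ^ α) ≤ mittagLeffler α (-(x ^ α)) := by
  have hlim : Tendsto (fun h : ℝ => (x + h) ^ (-α) * (1 - mittagLeffler α (-(x ^ α)))) (𝓝[>] 0)
      (𝓝 (x ^ (-α) * (1 - mittagLeffler α (-(x ^ α))))) := by
    have hc : ContinuousAt (fun h : ℝ => (x + h) ^ (-α)) 0 :=
      ContinuousAt.rpow_const (by fun_prop) (Or.inl (by simpa using hx.ne'))
    have := (hc.tendsto.mul_const (1 - mittagLeffler α (-(x ^ α)))).mono_left
      (nhdsWithin_le_nhds (s := Ioi 0))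
    simpa using this
  have hle := le_of_tendsto hlim (eventually_mem_nhdsWithin.mono fun h hh =>
    one_sub_mittagLeffler_le h0 h1 hx hh)
  have hG := Real.Gamma_pos_of_pos (by linarith : 0 < 1 - α)
  have hp := Real.rpow_pos_of_pos hx α
  rw [div_le_iff₀ (by positivity)]
  rw [Real.rpow_neg hx.le, ← div_eq_inv_mul, div_le_iff₀ hp] at hle
  linarith

/-! ### Comparison at the upper endpoint, and the crossing point -/

/-- Let k_γ(y) = (x-y)^(γ-1)/Γ(γ). By `he`, k_α and k_β have equal mass on (0, x), and k_β puts more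
weight on small y, where F_β is larger. Hence 1 - F_α(x) = ∫ k_α F_α < ∫ k_α F_β ≤ ∫ k_β F_β = 1 -
F_β(x). -/
theorem mittagLeffler_lt_of_forall_lt {α β x : ℝ} (ha : 0 < α) (hab : α < β) (hb1 : β < 1)
    (hx : 0 < x) (he : x ^ α / Real.Gamma (1 + α) = x ^ β / Real.Gamma (1 + β))
    (hlt : ∀ y ∈ Ioo 0 x, mittagLeffler α (-(y ^ α)) < mittagLeffler β (-(y ^ β))) :
    mittagLeffler β (-(x ^ β)) < mittagLeffler α (-(x ^ α)) := by
  have hb := ha.trans hab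
  have hGa := Real.Gamma_pos_of_pos ha
  have hGb := Real.Gamma_pos_of_pos hb
  have hIa := intervalIntegrable_sub_rpow ha x 0 x
  have hIb := intervalIntegrable_sub_rpow hb x 0 x
  have hca := (continuous_mittagLeffler_neg_rpow ha).continuousOn (s := uIcc 0 x)
  have hcb := (continuous_mittagLeffler_neg_rpow hb).continuousOn (s := uIcc 0 x)
  have hanti := strictAntiOn_mittagLeffler_neg_rpow hb hb1
  have h1 := intervalIntegral.intervalIntegral_pos_of_pos_on (f := fun y =>
    (x - y) ^ (α - 1) * mittagLeffler β (-(y ^ β)) -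
      (x - y) ^ (α - 1) * mittagLeffler α (-(y ^ α)))
    ((hIa.mul_continuousOn hcb).sub (hIa.mul_continuousOn hca)) (fun y hy => by
      rw [← mul_sub]
      exact mul_pos (Real.rpow_pos_of_pos (sub_pos.2 hy.2) _) (sub_pos.2 (hlt y hy))) hx
  rw [intervalIntegral.integral_sub (hIa.mul_continuousOn hcb) (hIa.mul_continuousOn hca),
    integral_sub_rpow_mul_mittagLeffler ha hx] at h1
  -- The two kernels cross at x - y = L.
  set L := (Real.Gamma β / Real.Gamma α) ^ (1 / (β - α)) with hL
  have hL0 : 0 < L := by positivity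
  have hLp : L ^ (β - α) = Real.Gamma β / Real.Gamma α := by
    rw [hL, ← Real.rpow_mul (by positivity), one_div_mul_cancel (sub_pos.2 hab).ne',
      Real.rpow_one]
  -- The value of F_β at the crossing; subtracting it is free because the masses agree. The maximum
  -- with 0 covers L ≥ x without excluding it.
  set κ := mittagLeffler β (-((max (x - L) 0) ^ β)) with hκ
  have hm : max (x - L) 0 ∈ Ici (0 : ℝ) := mem_Ici.2 (le_max_right _ _)
  have hd : ∀ y ∈ Ioo 0 x, (x - y) ^ (β - 1) / Real.Gamma β - (x - y) ^ (α - 1) / Real.Gamma α =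
      (x - y) ^ (α - 1) / Real.Gamma β * ((x - y) ^ (β - α) - L ^ (β - α)) := by
    intro y hy
    rw [hLp, show β - 1 = (α - 1) + (β - α) by ring, Real.rpow_add (sub_pos.2 hy.2)]
    field_simp
  have hda : IntervalIntegrable (fun y => (x - y) ^ (β - 1) / Real.Gamma β -
      (x - y) ^ (α - 1) / Real.Gamma α) volume 0 x :=
    (hIb.div_const _).sub (hIa.div_const _)
  have h2 : 0 ≤ ∫ y in (0 : ℝ)..x, ((x - y) ^ (β - 1) / Real.Gamma β -
      (x - y) ^ (α - 1) / Real.Gamma α) * (mittagLeffler β (-(y ^ β)) - κ) := by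
    have := intervalIntegral.integral_mono_on_of_le_Ioo (f := fun _ => (0 : ℝ)) (g := fun y =>
      ((x - y) ^ (β - 1) / Real.Gamma β -
      (x - y) ^ (α - 1) / Real.Gamma α) * (mittagLeffler β (-(y ^ β)) - κ)) hx.le (by simp)
      (hda.mul_continuousOn (hcb.sub continuousOn_const)) fun y hy => by
        rw [hd y hy]
        have hp : 0 < (x - y) ^ (α - 1) / Real.Gamma β :=
          div_pos (Real.rpow_pos_of_pos (sub_pos.2 hy.2) _) hGb
        rcases le_total y (max (x - L) 0) with h | h
        · have hyL : y ≤ x - L := by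
            rcases le_max_iff.1 h with h | h
            · exact h
            · exact absurd hy.1 h.not_gt
          refine mul_nonneg (mul_nonneg hp.le (sub_nonneg.2 ?_)) (sub_nonneg.2 ?_)
          · exact Real.rpow_le_rpow hL0.le (by linarith) (by linarith)
          · exact hanti.antitoneOn hy.1.le hm h
        · have hyL : x - L ≤ y := (le_max_left _ _).trans h
          refine mul_nonneg_of_nonpos_of_nonpos
            (mul_nonpos_of_nonneg_of_nonpos hp.le (sub_nonpos.2 ?_)) (sub_nonpos.2 ?_)
          · exact Real.rpow_le_rpow (sub_nonneg.2 hy.2.le) (by linarith) (by linarith)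
          · exact hanti.antitoneOn hm hy.1.le h
    simpa using this
  have h3 : ∫ y in (0 : ℝ)..x, ((x - y) ^ (β - 1) / Real.Gamma β -
      (x - y) ^ (α - 1) / Real.Gamma α) = 0 := by
    rw [intervalIntegral.integral_sub (hIb.div_const _) (hIa.div_const _),
      intervalIntegral.integral_div, intervalIntegral.integral_div, integral_sub_rpow ha,
      integral_sub_rpow hb]
    rw [add_comm 1, add_comm 1, Real.Gamma_add_one ha.ne', Real.Gamma_add_one hb.ne'] at he
    rw [div_div, div_div, he, sub_self]
  have e : ∀ y, ((x - y) ^ (β - 1) / Real.Gamma β -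
      (x - y) ^ (α - 1) / Real.Gamma α) * (mittagLeffler β (-(y ^ β)) - κ) =
      ((x - y) ^ (β - 1) * mittagLeffler β (-(y ^ β)) / Real.Gamma β -
      (x - y) ^ (α - 1) * mittagLeffler β (-(y ^ β)) / Real.Gamma α) -
      κ * ((x - y) ^ (β - 1) / Real.Gamma β - (x - y) ^ (α - 1) / Real.Gamma α) :=
    fun y => by ring
  have i1 := (hIb.mul_continuousOn hcb).div_const (Real.Gamma β)
  have i2 := (hIa.mul_continuousOn hcb).div_const (Real.Gamma α)
  simp only [e] at h2
  rw [intervalIntegral.integral_sub (i1.sub i2) (hda.const_mul _),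
    intervalIntegral.integral_sub i1 i2, intervalIntegral.integral_const_mul, h3,
    intervalIntegral.integral_div, intervalIntegral.integral_div,
    integral_sub_rpow_mul_mittagLeffler hb hx, mul_div_cancel_left₀ _ hGb.ne', mul_zero, sub_zero,
    sub_nonneg, div_le_iff₀ hGa] at h2
  have h4 : Real.Gamma α * (1 - mittagLeffler α (-(x ^ α))) <
      Real.Gamma α * (1 - mittagLeffler β (-(x ^ β))) := by linarith
  linarith [lt_of_mul_lt_mul_left h4 hGa.le]

theorem exists_crossing {α β : ℝ} (ha : 0 < α) (hab : α < β) (hb1 : β < 1) :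
    ∃ x₀ ∈ Set.Ioo (0 : ℝ) 1,
      (∀ x ∈ Set.Ioo (0 : ℝ) x₀,
        mittagLeffler α (-(x ^ α)) - mittagLeffler β (-(x ^ β)) < 0) ∧
      (∀ x ∈ Set.Ioi x₀,
        0 < mittagLeffler α (-(x ^ α)) - mittagLeffler β (-(x ^ β))) ∧
      (1 / (Real.Gamma (1 - β) * Real.Gamma (1 + α))) ^ (1 / (β - α)) < x₀ ∧
      x₀ < (Real.Gamma (1 + β) / Real.Gamma (1 + α)) ^ (1 / (β - α)) := by
  have hb := ha.trans hab
  have hd : 0 < β - α := sub_pos.2 hab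
  have hGa : 0 < Real.Gamma (1 + α) := Real.Gamma_pos_of_pos (by linarith)
  have hGb : 0 < Real.Gamma (1 + β) := Real.Gamma_pos_of_pos (by linarith)
  have hGb' : 0 < Real.Gamma (1 - β) := Real.Gamma_pos_of_pos (by linarith)
  have hpow : ∀ r : ℝ, 0 < r → (r ^ (1 / (β - α))) ^ β = (r ^ (1 / (β - α))) ^ α * r := by
    intro r hr
    have : (r ^ (1 / (β - α))) ^ (β - α) = r := by
      rw [← Real.rpow_mul hr.le, one_div_mul_cancel hd.ne', Real.rpow_one]
    rw [show β = α + (β - α) by ring, Real.rpow_add (by positivity), add_sub_cancel_left, this]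
  set f : ℝ → ℝ := fun x => mittagLeffler α (-(x ^ α)) - mittagLeffler β (-(x ^ β)) with hf
  have hfc : Continuous f :=
    (continuous_mittagLeffler_neg_rpow ha).sub (continuous_mittagLeffler_neg_rpow hb)
  have hstep : ∀ x y, 0 < x → x < y → 0 ≤ f x → 0 < f y := fun x y hx hxy h =>
    mittagLeffler_sub_pos_of_lt ha hab hb1 hx hxy h
  have hone : 0 < f 1 := mittagLeffler_sub_pos_one ha hab hb1
  set lo := (1 / (Real.Gamma (1 - β) * Real.Gamma (1 + α))) ^ (1 / (β - α)) with hlo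
  have hlo0 : 0 < lo := by positivity
  -- lo solves Γ(1-β) x^β = x^α/Γ(1+α), where the upper bound for F_α equals the lower bound for
  -- F_β.
  have hflo : f lo < 0 := by
    have h1 := mittagLeffler_neg_rpow_lt ha (hab.trans hb1) hlo0
    have h2 := le_mittagLeffler_neg_rpow hb hb1 hlo0
    have h3 : Real.Gamma (1 - β) * lo ^ β = lo ^ α / Real.Gamma (1 + α) := by
      rw [hpow _ (by positivity), ← hlo]
      field_simp
    rw [h3] at h2
    exact sub_neg.2 (h1.trans_le h2)
  -- Otherwise f(1) > 0 would propagate to f(lo) > 0.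
  have hlo1 : lo < 1 := by
    by_contra! h
    rcases eq_or_lt_of_le h with h | h
    · rw [← h] at hflo; linarith
    · linarith [hstep 1 lo one_pos h hone.le]
  obtain ⟨x₀, ⟨hx1, hx2⟩, hx0⟩ := intermediate_value_Icc hlo1.le hfc.continuousOn
    (show (0 : ℝ) ∈ Icc (f lo) (f 1) from ⟨hflo.le, hone.le⟩)
  have hlox : lo < x₀ := lt_of_le_of_ne hx1 fun h => by rw [h] at hflo; linarith
  have hx₀1 : x₀ < 1 := lt_of_le_of_ne hx2 fun h => by rw [h] at hx0; linarith
  have hneg : ∀ x ∈ Ioo 0 x₀, f x < 0 := by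
    intro x hx
    by_contra! h
    linarith [hstep x x₀ hx.1 hx.2 h]
  refine ⟨x₀, ⟨hlo0.trans hlox, hx₀1⟩, hneg,
    fun x hx => hstep x₀ x (hlo0.trans hlox) hx hx0.ge, hlox, ?_⟩
  set hi := (Real.Gamma (1 + β) / Real.Gamma (1 + α)) ^ (1 / (β - α)) with hhi
  have hhi0 : 0 < hi := by positivity
  -- If hi ≤ x₀, then f < 0 on (0, hi), and the comparison gives f(hi) > 0, whereas f ≤ 0 on (0,
  -- x₀].
  by_contra! h
  have h1 : 0 < f hi := sub_pos.2 <| mittagLeffler_lt_of_forall_lt ha hab hb1 hhi0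
    (by
      rw [hpow _ (by positivity), ← hhi]
      field_simp)
    fun y hy => sub_neg.1 (hneg y ⟨hy.1, hy.2.trans_le h⟩)
  rcases eq_or_lt_of_le h with h | h
  · rw [h] at h1; linarith
  · linarith [hneg hi ⟨hhi0, h⟩]

end MittagLeffler

theorem theoremB :
    (∀ α β : ℝ, 0 < α → α < β → β < 1 →
      ∃ x₀ ∈ Set.Ioo (0 : ℝ) 1,
        (∀ x ∈ Set.Ioo (0 : ℝ) x₀,
          mittagLeffler α (-(x ^ α)) - mittagLeffler β (-(x ^ β)) < 0) ∧
        (∀ x ∈ Set.Ioi x₀,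
          0 < mittagLeffler α (-(x ^ α)) - mittagLeffler β (-(x ^ β))) ∧
        (1 / (Real.Gamma (1 - β) * Real.Gamma (1 + α))) ^ (1 / (β - α)) < x₀ ∧
        x₀ < (Real.Gamma (1 + β) / Real.Gamma (1 + α)) ^ (1 / (β - α))) ∧
    (∀ x : ℝ, 1 ≤ x →
      StrictAntiOn (fun α : ℝ => mittagLeffler α (-(x ^ α))) (Set.Ioo (0 : ℝ) 1)) := by
  refine ⟨fun α β ha hab hb1 => MittagLeffler.exists_crossing ha hab hb1,
    fun x hx α hα β hβ hab => ?_⟩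
  obtain ⟨x₀, hx₀, -, hpos, -⟩ := MittagLeffler.exists_crossing hα.1 hab hβ.2
  exact sub_pos.1 (hpos x (lt_of_lt_of_le hx₀.2 hx))
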